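/- Let $\mathcal M$ be a structural causal model (cycles allowed) with finitely many endogenous variables $(X_i)_{i\in I}$ and finitely many jointly independent exogenous variables $(E_j)_{j\in J}$, all with values in standard Borel spaces, and with measurable structural equations $X_i=f_i\big((X_k)_{k\in I},(E_j)_{j\in J}\big)$. A variable $k\in I\cup J$ is a \emph{parent} of $i\in I$ if there is no measurable function $\tilde f_i$ not depending on the variable $k$ such that for almost every $e$ and all $x$: $x_i=f_i(x,e)\iff x_i=\tilde f_i(x,e)$. Assume that $\mathcal M$ is \emph{simple}: for every $O\subseteq I$ there is a measurable function $g_O$ of the endogenous parents of $O$ outside $O$ and the exogenous parents of $O$, such that for almost every $e$ and all $x$: $x_O=g_O(x,e)\iff x_O=f_O(x,e)$. Its directed mixed graph $\mathcal G$ has node set $I$, with $u\to v$ ($u\ne v$) if $u$ is a parent of $v$, and $u\leftrightarrow v$ ($u\neq v$) if $u$ and $v$ have a common exogenous parent. Ancestors are taken reflexively, and $u,v$ lie in the same strongly connected component if each is an ancestor of the other. A path in $\mathcal G$ is $\sigma$-blocked by $C\subseteq I$ if one of its endpoints is in $C$, or it contains a collider that is not an ancestor of $C$, or it contains a non-collider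 in $C$ that points to an adjacent node on the path in another strongly connected component; two nodes are $\sigma$-separated by $C$ if all paths between them are $\sigma$-blocked by $C$. Let $\mathbb P$ be the (unique) law of the endogenous variables solving the structural equations, and assume that it is $\sigma$-faithful: whenever distinct variables $a,b\notin C$ are conditionally independent given $C$ under $\mathbb P$, they are $\sigma$-separated by $C$ in $\mathcal G$. Let $V,W,X,Y$ be distinct endogenous variables and let $\mathbf S$ be a (possibly empty) set of endogenous variables (the selection bias variables) not containing any of them. Suppose the Extended Y-Structure conditions hold under $\mathbb P$: $$V\perp\!\!\!\perp Y\mid \{X\}\cup\mathbf S,\qquad V\not\perp\!\!\!\perp Y\mid \mathbf S,\qquad V\not\perp\!\!\!\perp W\mid \{X\}\cup\mathbf S,\qquad V\perp\!\!\!\perp W\mid \mathbf S .$$ Then $X$ is an ancestor of $Y$ in $\mathcal G$, and this causal relation is identifiable under selection: $$\mathbb P\big(Y\mid \mathrm{do}(X),\mathbf S\big)=\mathbb P\big(Y\mid X,\mathbf S\big),$$ in the sense that there is a Markov kernel $\kappa(dy\mid x,s)$ that is a version of the conditional distribution of $Y$ given $(X,\mathbf S)$ under $\mathbb P$ and such that,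 for every value $\xi$ of $X$, $\kappa(dy\mid \xi,s)$ is a version of the conditional distribution of $Y$ given $\mathbf S=s$ under the law of the intervened model, in which the structural equation of $X$ is replaced by $X=\xi$. -/

import Mathlib

open MeasureTheory ProbabilityTheory

/-! ### Directed mixed graphs and σ-separation -/

/-- A directed mixed graph: directed edges `u → v` and bidirected edges `u ↔ v`
between pairs of different nodes. -/
structure DMG (N : Type*) where
  /-- `dir u v` is the directed edge `u → v`. -/
  dir : N → N → Prop
  /-- `bi u v` is the bidirected edge `u ↔ v`. -/
  bi : N → N → Prop
  dir_ne : ∀ {u v}, dir u v → u ≠ v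
  bi_ne : ∀ {u v}, bi u v → u ≠ v
  bi_symm : ∀ {u v}, bi u v → bi v u

/-- The three kinds of edge that a walk can traverse from `u` to `v`:
`u → v`, `u ← v` and `u ↔ v`. -/
inductive EdgeKind
  | fwd
  | bwd
  | bidir

/-- The edge has an arrowhead at the node where it is left. -/
def EdgeKind.HeadAtStart : EdgeKind → Prop
  | .fwd => False
  | .bwd => True
  | .bidir => True

/-- The edge has an arrowhead at the node where it arrives. -/
def EdgeKind.HeadAtEnd : EdgeKind → Prop
  | .fwd => True
  | .bwd => False
  | .bidir => True

namespace DMG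

variable {N : Type*} (G : DMG N)

/-- `G.HasEdge k u v`: the graph contains the edge of kind `k` traversed from `u` to `v`. -/
def HasEdge : EdgeKind → N → N → Prop
  | .fwd, u, v => G.dir u v
  | .bwd, u, v => G.dir v u
  | .bidir, u, v => G.bi u v

/-- `u` is an ancestor of `v` (every node is an ancestor of itself). -/
def IsAncestor (u v : N) : Prop := Relation.ReflTransGen G.dir u v

/-- The set of ancestors of a set of nodes. -/
def ancestors (C : Set N) : Set N := {u | ∃ c ∈ C, G.IsAncestor u c}

/-- `u` and `v` lie in the same strongly connected component. -/
def SameSCC (u v : N) : Prop := G.IsAncestor u v ∧ G.IsAncestor v u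

/-- Walks: alternating sequences of nodes and edges. -/
inductive Walk : N → N → Type _
  | nil (u : N) : Walk u u
  | cons {u v w : N} (k : EdgeKind) (h : G.HasEdge k u v) (p : Walk v w) : Walk u w

namespace Walk

variable {G}

/-- The list of nodes on a walk. -/
def support : {u v : N} → G.Walk u v → List N
  | u, _, nil _ => [u]
  | u, _, cons _ _ p => u :: p.support

/-- A path is a walk on which every node occurs at most once. -/
def IsPath {u v : N} (p : G.Walk u v) : Prop := p.support.Nodup

/-- On a walk segment `u (k₁) v (k₂) w`, the interior node `v` blocks the walk given `C`: either
`v` is a collider that is not an ancestor of `C`, or `v` is a non-collider in `C` that points to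
one of its two neighbours on the walk which lies in another strongly connected component. -/
def BlocksAt (G : DMG N) (C : Set N) (u : N) (k₁ : EdgeKind) (v : N) (k₂ : EdgeKind) (w : N) :
    Prop :=
  ((k₁.HeadAtEnd ∧ k₂.HeadAtStart) ∧ v ∉ G.ancestors C) ∨
  (¬ (k₁.HeadAtEnd ∧ k₂.HeadAtStart) ∧ v ∈ C ∧
    ((k₁ = EdgeKind.bwd ∧ ¬ G.SameSCC v u) ∨ (k₂ = EdgeKind.fwd ∧ ¬ G.SameSCC v w)))

/-- Some interior node of the walk `u₀ (k₀) p` blocks it, where `u₀ (k₀)` are the node and the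
edge that precede the walk `p`. -/
def InteriorBlockedAfter (C : Set N) (u₀ : N) (k₀ : EdgeKind) :
    {u v : N} → G.Walk u v → Prop
  | _, _, nil _ => False
  | u, _, cons (v := v) k _ p => BlocksAt G C u₀ k₀ u k v ∨ InteriorBlockedAfter C u k p

/-- Some interior node of the walk blocks it. -/
def InteriorBlocked (C : Set N) : {u v : N} → G.Walk u v → Prop
  | _, _, nil _ => False
  | u, _, cons k _ p => InteriorBlockedAfter C u k p

/-- The walk is σ-blocked by `C`. -/
def SigmaBlocked (C : Set N) {u v : N} (p : G.Walk u v) : Prop :=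
  u ∈ C ∨ v ∈ C ∨ p.InteriorBlocked C

end Walk

/-- `u` and `v` are σ-separated by `C`: all paths between them are σ-blocked by `C`. -/
def SigmaSep (u v : N) (C : Set N) : Prop :=
  ∀ p : G.Walk u v, p.IsPath → p.SigmaBlocked C

end DMG

/-! ### Structural causal models -/

/-- A structural causal model with endogenous variables indexed by `I` (values in `𝒳 i`),
jointly independent exogenous variables indexed by `J` (values in `ℰ j`, with laws `noise j`),
and one measurable causal mechanism per endogenous variable. Cycles are allowed. -/
structure SCM (I J : Type*) (𝒳 : I → Type*) (ℰ : J → Type*)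
    [∀ i, MeasurableSpace (𝒳 i)] [∀ j, MeasurableSpace (ℰ j)] where
  /-- The causal mechanisms. -/
  f : ∀ i, (∀ k, 𝒳 k) × (∀ j, ℰ j) → 𝒳 i
  measurable_f : ∀ i, Measurable (f i)
  /-- The laws of the exogenous variables. -/
  noise : ∀ j, Measure (ℰ j)
  prob_noise : ∀ j, IsProbabilityMeasure (noise j)

namespace SCM

variable {I J : Type*} {𝒳 : I → Type*} {ℰ : J → Type*}
  [∀ i, MeasurableSpace (𝒳 i)] [∀ j, MeasurableSpace (ℰ j)]

section Noise

variable [Fintype J] (M : SCM I J 𝒳 ℰ)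

/-- The joint law of the exogenous variables. -/
noncomputable def exoLaw : Measure (∀ j, ℰ j) := Measure.pi M.noise

/-- The endogenous variable `k` is a parent of `i`: the structural equation of `i` is not
equivalent to one that does not contain the variable `k`. -/
def EndoParent (k i : I) : Prop :=
  ¬ ∃ f' : (∀ l : ↥({k}ᶜ : Set I), 𝒳 l) × (∀ j, ℰ j) → 𝒳 i, Measurable f' ∧
    ∀ᵐ e ∂M.exoLaw, ∀ x : ∀ l, 𝒳 l,
      x i = M.f i (x, e) ↔ x i = f' (({k}ᶜ : Set I).domRestrict x, e)

/-- The exogenous variable `j` is a parent of `i`: the structural equation of `i` is not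
equivalent to one that does not contain the variable `j`. -/
def ExoParent (j : J) (i : I) : Prop :=
  ¬ ∃ f' : (∀ l, 𝒳 l) × (∀ l : ↥({j}ᶜ : Set J), ℰ l) → 𝒳 i, Measurable f' ∧
    ∀ᵐ e ∂M.exoLaw, ∀ x : ∀ l, 𝒳 l,
      x i = M.f i (x, e) ↔ x i = f' (x, ({j}ᶜ : Set J).domRestrict e)

/-- The endogenous parents of a set of endogenous variables. -/
def endoPa (O : Set I) : Set I := {k | ∃ i ∈ O, M.EndoParent k i}

/-- The exogenous parents of a set of endogenous variables. -/
def exoPa (O : Set I) : Set J := {j | ∃ i ∈ O, M.ExoParent j i}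

/-- The directed mixed graph of the model: `u → v` if `u` is a parent of `v`, and `u ↔ v` if
`u` and `v` have a common exogenous parent. -/
def graph : DMG I where
  dir u v := u ≠ v ∧ M.EndoParent u v
  bi u v := u ≠ v ∧ ∃ j, M.ExoParent j u ∧ M.ExoParent j v
  dir_ne h := h.1
  bi_ne h := h.1
  bi_symm h := ⟨h.1.symm, h.2.imp fun _ hj => ⟨hj.2, hj.1⟩⟩

/-- Unique solvability with respect to `O`: the structural equations of the variables in `O` can
be solved uniquely and measurably for these variables in terms of their other parents. -/
def UniquelySolvable (O : Set I) : Prop :=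
  ∃ g : (∀ k : ↥(M.endoPa O \ O), 𝒳 k) × (∀ j : ↥(M.exoPa O), ℰ j) → ∀ i : ↥O, 𝒳 i,
    Measurable g ∧
    ∀ᵐ e ∂M.exoLaw, ∀ x : ∀ l, 𝒳 l,
      (∀ i : ↥O, x i = g ((M.endoPa O \ O).domRestrict x, (M.exoPa O).domRestrict e) i) ↔
      (∀ i : ↥O, x i = M.f i (x, e))

/-- A simple model is uniquely solvable with respect to every set of endogenous variables. -/
def IsSimple : Prop := ∀ O : Set I, M.UniquelySolvable O

/-- `μ` is the law of the endogenous part of a solution of the model: there is a coupling of the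
endogenous variables, with law `μ`, and the exogenous variables under which all structural
equations hold almost surely. In a simple model there is exactly one such `μ`. -/
def IsSolutionLaw (μ : Measure (∀ i, 𝒳 i)) : Prop :=
  ∃ ρ : Measure ((∀ i, 𝒳 i) × (∀ j, ℰ j)),
    ρ.fst = μ ∧ ρ.snd = M.exoLaw ∧ ∀ᵐ z ∂ρ, ∀ i, z.1 i = M.f i z

end Noise

/-- The perfect intervention `do(X = ξ)`: the mechanism of `X` is replaced by the constant `ξ`. -/
def intervene [DecidableEq I] (M : SCM I J 𝒳 ℰ) (X : I) (ξ : 𝒳 X) : SCM I J 𝒳 ℰ where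
  f := Function.update M.f X (fun _ => ξ)
  measurable_f := by
    intro i
    by_cases h : i = X
    · subst h
      simp
    · simpa [Function.update_of_ne h] using M.measurable_f i
  noise := M.noise
  prob_noise := M.prob_noise

end SCM

/-! ### Conditional independence -/

section CondIndependence

variable {I : Type*} {𝒳 : I → Type*} [Countable I] [∀ i, MeasurableSpace (𝒳 i)]
  [∀ i, StandardBorelSpace (𝒳 i)]

/-- Under the joint law `μ`, the variables `a` and `b` are conditionally independent given the
variables in `C`. -/
def CondIndepVars (μ : Measure (∀ i, 𝒳 i)) [IsFiniteMeasure μ] (a b : I) (C : Set I) : Prop :=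
  CondIndepFun (MeasurableSpace.comap (C.domRestrict : (∀ i, 𝒳 i) → ∀ i : ↥C, 𝒳 i) inferInstance)
    (Measurable.comap_le (measurable_pi_lambda _ fun i => measurable_pi_apply (i : I)))
    (fun x : ∀ i, 𝒳 i => x a) (fun x : ∀ i, 𝒳 i => x b) μ

/-- Minimal conditional independence of `a` and `b` given `W ∪ [Z]`. -/
def MinCondIndep (μ : Measure (∀ i, 𝒳 i)) [IsFiniteMeasure μ] (a b : I) (W Z : Set I) : Prop :=
  CondIndepVars μ a b (W ∪ Z) ∧ ∀ Z' : Set I, Z' ⊂ Z → ¬ CondIndepVars μ a b (W ∪ Z')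

/-- Minimal conditional dependence of `a` and `b` given `W ∪ [Z]`. -/
def MinCondDep (μ : Measure (∀ i, 𝒳 i)) [IsFiniteMeasure μ] (a b : I) (W Z : Set I) : Prop :=
  ¬ CondIndepVars μ a b (W ∪ Z) ∧ ∀ Z' : Set I, Z' ⊂ Z → CondIndepVars μ a b (W ∪ Z')

/-- σ-faithfulness: all conditional independences in `μ` are explained by σ-separations in `G`. -/
def SigmaFaithful (G : DMG I) (μ : Measure (∀ i, 𝒳 i)) [IsFiniteMeasure μ] : Prop :=
  ∀ (a b : I) (C : Set I), a ≠ b → a ∉ C → b ∉ C → CondIndepVars μ a b C → G.SigmaSep a b C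

end CondIndependence

/-! ### Open walks, open paths and moral chains. -/

namespace DMG

variable {N : Type*} {G : DMG N}

/-! Faithfulness turns the two independences into σ-separations, and the global Markov property
`SCM.IsSimple.condIndepVars` turns the two dependences into open paths. What remains is a graph
argument and an identification argument.

Graph (`extended_y_structure`): a V–W path q that is open given S ∪ {X} is blocked given S, so it
contains a collider that is an ancestor of X but not of S. Hence X is not an ancestor of S. It is
not an ancestor of V either: a directed path from the last such collider to V, reversed and followed
by the rest of q, would be open given S. A V–Y path that is open given S becomes blocked when X is
added, so X is a non-collider on it that points outwards; following the path makes X an ancestor of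
S, V or Y, and only Y is left. Moreover, no chain of `MoralStep`s leads from X to Y: it would give a
walk that can be grafted onto q at its first collider blocked by S, connecting V and Y given S ∪
{X}.

Markov property (`condIndep_of_not_moralChain`): colour the nodes by whether a chain from a reaches
them. The noise variables split into two independent groups by colour, and each variable is a
function of the noise of its own colour and of conditioned variables that precede it. Adding the
conditioned variables one at a time, ancestors first, preserves independence. Cycles are handled by
solving each strongly connected component as a block.

Identification (`SCM.IsSimple.exists_intervention_kernel`): an independent fair coin decides whether
X is set to an independent value ξ drawn from the law of X. Coin and ξ act only on X, so in the
absence of a chain they are independent of Y given X and S, and one kernel serves both outcomes of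
the coin. This settles almost every ξ. On the exceptional null set the kernel is replaced by the
interventional conditional law, which does not affect the observational one. -/

lemma subset_ancestors (C : Set N) : C ⊆ G.ancestors C := fun c hc => ⟨c, hc, .refl⟩

lemma ancestors_mono {C D : Set N} (h : C ⊆ D) : G.ancestors C ⊆ G.ancestors D :=
  fun _ ⟨c, hc, huc⟩ => ⟨c, h hc, huc⟩

lemma IsAncestor.mem_ancestors {u v : N} {C : Set N} (h : G.IsAncestor u v)
    (hv : v ∈ G.ancestors C) : u ∈ G.ancestors C :=
  let ⟨c, hc, hvc⟩ := hv
  ⟨c, hc, h.trans hvc⟩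

lemma isAncestor_of_dir {u v : N} (h : G.dir u v) : G.IsAncestor u v := .single h

lemma ancestors_insert (C : Set N) (x : N) :
    G.ancestors (C ∪ {x}) = G.ancestors C ∪ {u | G.IsAncestor u x} := by
  ext u
  constructor
  · rintro ⟨c, hc | rfl, h⟩
    · exact .inl ⟨c, hc, h⟩
    · exact .inr h
  · rintro (⟨c, hc, h⟩ | h)
    · exact ⟨c, .inl hc, h⟩
    · exact ⟨x, .inr rfl, h⟩

namespace Walk

lemma interiorBlockedAfter_cons {C : Set N} {u₀ u v w : N} {k₀ k : EdgeKind}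
    {h : G.HasEdge k u v} {p : G.Walk v w} :
    (cons k h p).InteriorBlockedAfter C u₀ k₀ ↔
      BlocksAt G C u₀ k₀ u k v ∨ p.InteriorBlockedAfter C u k := Iff.rfl

lemma not_interiorBlockedAfter_cons {C : Set N} {u₀ u v w : N} {k₀ k : EdgeKind}
    {h : G.HasEdge k u v} {p : G.Walk v w} (h₁ : ¬ BlocksAt G C u₀ k₀ u k v)
    (h₂ : ¬ p.InteriorBlockedAfter C u k) : ¬ (cons k h p).InteriorBlockedAfter C u₀ k₀ :=
  not_or.2 ⟨h₁, h₂⟩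

lemma interiorBlocked_of_after {C : Set N} {u₀ u v : N} {k₀ : EdgeKind} {p : G.Walk u v}
    (h : p.InteriorBlocked C) : p.InteriorBlockedAfter C u₀ k₀ := by
  cases p with
  | nil => exact h
  | cons k e p => exact .inr h

/-- A suffix of an open path starting at a given node of that path is open. If the path is
entered through an arrowhead, then its first node is an ancestor of `C` or the suffix is
entered through an arrowhead. -/
lemma exists_suffix {C : Set N} {u v : N} (q : G.Walk u v) (x : N) :
    ∀ (u₀ : N) (k₀ : EdgeKind), ¬ q.InteriorBlockedAfter C u₀ k₀ → q.IsPath → x ∈ q.support →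
    ∃ r : G.Walk x v, r.IsPath ∧ ∃ u₁ k₁, ¬ r.InteriorBlockedAfter C u₁ k₁ ∧
      (k₀.HeadAtEnd → u ∈ G.ancestors C ∨ k₁.HeadAtEnd) := by
  induction q with
  | nil u =>
    intro u₀ k₀ ho hp hx
    obtain rfl : x = u := by simpa [support] using hx
    exact ⟨nil x, hp, u₀, k₀, ho, Or.inr⟩
  | @cons u w v k h p ih =>
    intro u₀ k₀ ho hp hx
    by_cases hxu : x = u
    · subst hxu
      exact ⟨cons k h p, hp, u₀, k₀, ho, Or.inr⟩
    · rw [interiorBlockedAfter_cons, not_or] at ho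
      have hx' : x ∈ p.support := by
        simpa [support, hxu] using hx
      obtain ⟨r, hr, u₁, k₁, hro, hh⟩ := ih u k ho.2 (List.nodup_cons.1 hp).2 hx'
      refine ⟨r, hr, u₁, k₁, hro, fun hk₀ => ?_⟩
      have hb := ho.1
      cases k with
      | fwd =>
        rcases hh trivial with hw | hk
        · exact .inl ((isAncestor_of_dir h).mem_ancestors hw)
        · exact .inr hk
      | bwd =>
        left; by_contra hu
        exact hb (.inl ⟨⟨hk₀, trivial⟩, hu⟩)
      | bidir =>
        left; by_contra hu
        exact hb (.inl ⟨⟨hk₀, trivial⟩, hu⟩)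

/-- An open walk can be shortened to an open path. -/
lemma exists_path_after {C : Set N} {u v : N} (p : G.Walk u v) :
    ∀ (u₀ : N) (k₀ : EdgeKind), ¬ p.InteriorBlockedAfter C u₀ k₀ →
    ∃ q : G.Walk u v, q.IsPath ∧ ¬ q.InteriorBlockedAfter C u₀ k₀ := by
  induction p with
  | nil u =>
    intro u₀ k₀ ho
    exact ⟨nil u, by simp [IsPath, support], ho⟩
  | @cons u w v k h p ih =>
    intro u₀ k₀ ho
    rw [interiorBlockedAfter_cons, not_or] at ho
    obtain ⟨q, hq, hqo⟩ := ih u k ho.2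
    by_cases hu : u ∈ q.support
    · obtain ⟨r, hr, u₁, k₁, hro, hh⟩ := exists_suffix q u u k hqo hq hu
      refine ⟨r, hr, ?_⟩
      cases r with
      | nil => exact id
      | @cons _ w' _ k' h' r =>
        rw [interiorBlockedAfter_cons, not_or] at hro ⊢
        refine ⟨?_, hro.2⟩
        obtain ⟨hb, -⟩ := ho
        obtain ⟨hb', -⟩ := hro
        -- The loop from `u` back to `u` is cut out. If `u` becomes a collider outside the ancestors
        -- of `C`, then the loop started with a forward edge. Following it shows that `u` is an
        -- ancestor of `C` or that the loop re-enters `u` through an arrowhead, where `u` already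
        -- blocked. If `u` becomes a blocking non-collider, the offending outgoing edge already
        -- blocked at the first or the last visit.
        rintro (⟨⟨hk₀, hk'⟩, hu'⟩ | ⟨hnc, huC, hout⟩)
        · have hkf : k = .fwd := by
            cases k with
            | fwd => rfl
            | bwd => exact (hb (.inl ⟨⟨hk₀, trivial⟩, hu'⟩)).elim
            | bidir => exact (hb (.inl ⟨⟨hk₀, trivial⟩, hu'⟩)).elim
          subst hkf
          rcases hh trivial with hw | hk₁
          · exact hu' ((isAncestor_of_dir h).mem_ancestors hw)
          · exact hb' (.inl ⟨⟨hk₁, hk'⟩, hu'⟩)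
        · rcases hout with ⟨rfl, hs⟩ | ⟨rfl, hs⟩
          · exact hb (.inr ⟨fun hc => hc.1, huC, .inl ⟨rfl, hs⟩⟩)
          · exact hb' (.inr ⟨fun hc => hc.2, huC, .inr ⟨rfl, hs⟩⟩)
    · exact ⟨cons k h q, List.nodup_cons.2 ⟨hu, hq⟩,
        by rw [interiorBlockedAfter_cons, not_or]; exact ⟨ho.1, hqo⟩⟩

lemma exists_path {C : Set N} {u v : N} (p : G.Walk u v) (ho : ¬ p.InteriorBlocked C) :
    ∃ q : G.Walk u v, q.IsPath ∧ ¬ q.InteriorBlocked C := by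
  cases p with
  | nil => exact ⟨nil u, by simp [IsPath, support], ho⟩
  | @cons _ w _ k h p =>
    obtain ⟨q, hq, hqo⟩ := exists_path_after p u k ho
    by_cases hu : u ∈ q.support
    · obtain ⟨r, hr, u₁, k₁, hro, -⟩ := exists_suffix q u u k hqo hq hu
      exact ⟨r, hr, fun hb => hro (interiorBlocked_of_after hb)⟩
    · exact ⟨cons k h q, List.nodup_cons.2 ⟨hu, hq⟩, hqo⟩

/-- Directed walks through nodes that are not ancestors of `C` are open. -/
lemma exists_directed {C : Set N} {u v : N} (h : G.IsAncestor u v) (hu : u ∉ G.ancestors C) :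
    ∃ p : G.Walk u v, ∀ u₀ k₀, ¬ p.InteriorBlockedAfter C u₀ k₀ := by
  induction h using Relation.ReflTransGen.head_induction_on with
  | refl => exact ⟨nil v, fun _ _ => id⟩
  | @head a c hac hcv ih =>
    obtain ⟨p, hp⟩ := ih fun hc => hu ((isAncestor_of_dir hac).mem_ancestors hc)
    refine ⟨cons .fwd hac p, fun u₀ k₀ => not_interiorBlockedAfter_cons ?_ (hp _ _)⟩
    rintro (⟨⟨-, h⟩, -⟩ | ⟨-, h, -⟩)
    · exact h
    · exact hu (subset_ancestors C h)

/-- Walks can be prolonged at their start, against the direction of the edges, through nodes that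
are not ancestors of `C`. -/
lemma exists_prepend_directed {C : Set N} {k v w : N} (h : G.IsAncestor k v)
    (hk : k ∉ G.ancestors C) (hp : ∃ p : G.Walk k w, ∀ u₀, ¬ p.InteriorBlockedAfter C u₀ .bwd) :
    ∃ p : G.Walk v w, ¬ p.InteriorBlocked C := by
  induction h using Relation.ReflTransGen.head_induction_on with
  | refl =>
    obtain ⟨p, hp⟩ := hp
    exact ⟨p, fun hb => hp v (interiorBlocked_of_after hb)⟩
  | @head a c hac hcv ih =>
    have hc : c ∉ G.ancestors C := fun hc => hk ((isAncestor_of_dir hac).mem_ancestors hc)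
    obtain ⟨p, hp⟩ := hp
    refine ih hc ⟨cons .bwd hac p, fun u₀ => not_interiorBlockedAfter_cons ?_ (hp c)⟩
    rintro (⟨⟨h, -⟩, -⟩ | ⟨-, h, -⟩)
    · exact h
    · exact hc (subset_ancestors C h)

end Walk

lemma SigmaSep.interiorBlocked {u v : N} {C : Set N} (h : G.SigmaSep u v C) (hu : u ∉ C)
    (hv : v ∉ C) (p : G.Walk u v) : p.InteriorBlocked C := by
  by_contra ho
  obtain ⟨q, hq, hqo⟩ := p.exists_path ho
  rcases h q hq with h | h | h
  exacts [hu h, hv h, hqo h]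

/-- One step of a chain in `A` along which dependence given `C` can propagate. -/
def MoralStep (G : DMG N) (A C : Set N) (i k : N) : Prop :=
  i ∈ A ∧ k ∈ A ∧
    ((G.dir i k ∧ (i ∉ C ∨ G.SameSCC i k)) ∨ (G.dir k i ∧ k ∉ C) ∨ G.bi i k)

/-- The walk is built from the end of the chain. The invariant covers entering `a` through an
arrowhead, or in any way if `a ∉ C`, so nodes of `C` do no harm. A node outside the ancestors of `C`
could be a blocking collider: there the rest is replaced by a directed walk to `b`, or the third
alternative of `hA` applies. `Goal` is an open walk when that alternative means an ancestor of `a`,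
and `False` when it never occurs. -/
lemma exists_walk_of_moralChain {A C : Set N} {a b : N} {Goal : Prop}
    (hA : ∀ i ∈ A, i ∈ G.ancestors C ∨ G.IsAncestor i b ∨
      (i ∉ G.ancestors C →
        (∃ p : G.Walk i b, ∀ u₀, ¬ p.InteriorBlockedAfter C u₀ .bwd) → Goal))
    (h : Relation.ReflTransGen (G.MoralStep A C) a b) :
    Goal ∨ ∃ p : G.Walk a b, ∀ u₀ k₀, k₀.HeadAtEnd ∨ a ∉ C →
      ¬ p.InteriorBlockedAfter C u₀ k₀ := by
  induction h using Relation.ReflTransGen.head_induction_on with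
  | refl => exact .inr ⟨.nil b, fun _ _ _ => id⟩
  | @head i k hik _ ih =>
    obtain hG | ⟨p, hp⟩ := ih
    · exact .inl hG
    obtain ⟨hi, -, hik⟩ := hik
    obtain ⟨kd, e, hkd, hC⟩ : ∃ kd, G.HasEdge kd i k ∧ (kd.HeadAtEnd ∨ k ∉ C) ∧
        (i ∈ C → kd = .fwd → G.SameSCC i k) := by
      rcases hik with ⟨e, h⟩ | ⟨e, h⟩ | e
      · exact ⟨.fwd, e, .inl trivial, fun hi _ => h.resolve_left (not_not.2 hi)⟩
      · exact ⟨.bwd, e, .inr h, by simp⟩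
      · exact ⟨.bidir, e, .inl trivial, by simp⟩
    have hq : ∀ u₀ k₀, (k₀.HeadAtEnd ∨ i ∉ C) → (k₀.HeadAtEnd → i ∈ G.ancestors C) →
        ¬ (Walk.cons kd e p).InteriorBlockedAfter C u₀ k₀ := by
      intro u₀ k₀ h1 h2
      rw [Walk.interiorBlockedAfter_cons, not_or]
      refine ⟨?_, hp _ _ hkd⟩
      rintro (⟨⟨h, -⟩, hn⟩ | ⟨-, hiC, ⟨rfl, -⟩ | ⟨hf, hs⟩⟩)
      · exact hn (h2 h)
      · exact h1.elim id fun h => h hiC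
      · exact hs (hC hiC hf)
    by_cases hiC : i ∈ G.ancestors C
    · exact .inr ⟨.cons kd e p, fun u₀ k₀ h => hq u₀ k₀ h fun _ => hiC⟩
    have hiC' : i ∉ C := fun h => hiC (subset_ancestors C h)
    rcases hA i hi with h | h | h
    · exact (hiC h).elim
    · obtain ⟨q, hq⟩ := Walk.exists_directed h hiC
      exact .inr ⟨q, fun u₀ k₀ _ => hq u₀ k₀⟩
    · exact .inl (h hiC ⟨.cons kd e p, fun u₀ => hq u₀ .bwd (.inr hiC') fun h => h.elim⟩)

/-- Chains between two nodes inside the ancestors of these nodes and of `C` yield open walks. -/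
lemma SigmaSep.not_moralChain {C : Set N} {a b : N} (h : G.SigmaSep a b C) (ha : a ∉ C)
    (hb : b ∉ C) : ¬ Relation.ReflTransGen (G.MoralStep (G.ancestors (C ∪ {a} ∪ {b})) C) a b := by
  intro hc
  have := exists_walk_of_moralChain (Goal := ∃ p : G.Walk a b, ¬ p.InteriorBlocked C) ?_ hc
  · rcases this with ⟨p, hp⟩ | ⟨p, hp⟩
    · exact hp (h.interiorBlocked ha hb p)
    · exact hp a .fwd (.inr ha) (Walk.interiorBlocked_of_after (h.interiorBlocked ha hb p))
  · intro i hi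
    rw [ancestors_insert, ancestors_insert] at hi
    rcases hi with (hi | hi) | hi
    · exact .inl hi
    · exact .inr (.inr fun hiC hp => Walk.exists_prepend_directed hi hiC hp)
    · exact .inr (.inl hi)

/-! ### Comparing the conditioning sets S and S ∪ {X}; the graph of a Y-structure. -/

namespace Walk

/-- Blocking non-colliders stay blocking when the conditioning set grows; only a collider can be
opened, and then by an ancestral relation to `X`. -/
lemma not_blocksAt_of_union {S : Set N} {X u₀ u v : N} {k₀ k : EdgeKind}
    (ho : ¬ BlocksAt G (S ∪ {X}) u₀ k₀ u k v) (hb : BlocksAt G S u₀ k₀ u k v) :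
    G.IsAncestor u X ∧ u ∉ G.ancestors S ∧ k₀.HeadAtEnd := by
  rcases hb with ⟨hc, hu⟩ | ⟨hc, hu, hout⟩
  · have : u ∈ G.ancestors (S ∪ {X}) := by
      by_contra h
      exact ho (.inl ⟨hc, h⟩)
    rw [ancestors_insert] at this
    exact ⟨this.resolve_left hu, hu, hc.1⟩
  · exact (ho (.inr ⟨hc, .inl hu, hout⟩)).elim

/-- If a walk is open given `S ∪ {X}` but not given `S`, then its initial part can be connected
to any walk from `X` that stays open when it is entered through an arrowhead. -/
lemma exists_graft {S : Set N} {X Y : N}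
    (hX : ∃ p : G.Walk X Y, ∀ u₀ k₀, k₀.HeadAtEnd → ¬ p.InteriorBlockedAfter (S ∪ {X}) u₀ k₀)
    {u w : N} (p : G.Walk u w) : ∀ u₀ k₀, ¬ p.InteriorBlockedAfter (S ∪ {X}) u₀ k₀ →
      p.InteriorBlockedAfter S u₀ k₀ →
      ∃ q : G.Walk u Y, ¬ q.InteriorBlockedAfter (S ∪ {X}) u₀ k₀ := by
  have hQ : ∀ i, G.IsAncestor i X → i ∉ G.ancestors S →
      ∃ p : G.Walk i Y, ∀ u₀ k₀, k₀.HeadAtEnd → ¬ p.InteriorBlockedAfter (S ∪ {X}) u₀ k₀ := by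
    intro i hi hiS
    induction hi using Relation.ReflTransGen.head_induction_on with
    | refl => exact hX
    | @head a c hac hcv ih =>
      obtain ⟨p, hp⟩ := ih fun hc => hiS ((isAncestor_of_dir hac).mem_ancestors hc)
      -- The directed path ends at its first visit to `X`, because `X` is conditioned on and might
      -- block as an interior non-collider.
      by_cases haX : a = X
      · subst haX
        exact hX
      refine ⟨cons .fwd hac p, fun u₀ k₀ hk₀ =>
        not_interiorBlockedAfter_cons ?_ (hp _ .fwd trivial)⟩
      rintro (⟨⟨-, h⟩, -⟩ | ⟨-, h, -⟩)
      · exact h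
      · exact h.elim (fun h => hiS (subset_ancestors S h)) haX
  induction p with
  | nil => exact fun _ _ _ h => h.elim
  | @cons u w v k h p ih =>
    intro u₀ k₀ ho hb
    rw [interiorBlockedAfter_cons, not_or] at ho
    rcases hb with hb | hb
    · obtain ⟨h1, h2, h3⟩ := not_blocksAt_of_union ho.1 hb
      obtain ⟨q, hq⟩ := hQ u h1 h2
      exact ⟨q, hq _ _ h3⟩
    · obtain ⟨q, hq⟩ := ih _ _ ho.2 hb
      exact ⟨cons k h q, by rw [interiorBlockedAfter_cons, not_or]; exact ⟨ho.1, hq⟩⟩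

/-- If a walk is open given `S ∪ {X}`, then it is open given `S` or it has a last collider that
is an ancestor of `X` but not of `S`. -/
lemma exists_last_collider {S : Set N} {X u w : N} (p : G.Walk u w) :
    ∀ u₀ k₀, ¬ p.InteriorBlockedAfter (S ∪ {X}) u₀ k₀ → ¬ p.InteriorBlockedAfter S u₀ k₀ ∨
      ∃ k, G.IsAncestor k X ∧ k ∉ G.ancestors S ∧
        ∃ q : G.Walk k w, ∀ u₁, ¬ q.InteriorBlockedAfter S u₁ .bwd := by
  induction p with
  | nil => exact fun _ _ h => .inl h
  | @cons u w v k h p ih =>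
    intro u₀ k₀ ho
    rw [interiorBlockedAfter_cons, not_or] at ho
    rcases ih _ _ ho.2 with hp | hp
    · by_cases hb : BlocksAt G S u₀ k₀ u k w
      · obtain ⟨h1, h2, -⟩ := not_blocksAt_of_union ho.1 hb
        refine .inr ⟨u, h1, h2, cons k h p, fun u₁ => ?_⟩
        rw [interiorBlockedAfter_cons, not_or]
        refine ⟨?_, hp⟩
        rintro (⟨⟨h, -⟩, -⟩ | ⟨-, h, -⟩)
        · exact h
        · exact h2 (subset_ancestors S h)
      · exact .inl (by rw [interiorBlockedAfter_cons, not_or]; exact ⟨hb, hp⟩)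
    · exact .inr hp

/-- The first node of an open walk that is entered through an arrowhead is an ancestor of the
conditioning set or of the last node. -/
lemma mem_ancestors_of_headAtEnd {S : Set N} {u v : N} (p : G.Walk u v) :
    ∀ u₀ k₀, k₀.HeadAtEnd → ¬ p.InteriorBlockedAfter S u₀ k₀ → u ∈ G.ancestors (S ∪ {v}) := by
  induction p with
  | nil u => exact fun _ _ _ _ => subset_ancestors _ (.inr rfl)
  | @cons u w v k h p ih =>
    intro u₀ k₀ hk ho
    rw [interiorBlockedAfter_cons, not_or] at ho
    cases k with
    | fwd => exact (isAncestor_of_dir h).mem_ancestors (ih _ .fwd trivial ho.2)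
    | bwd =>
      by_contra hu
      exact ho.1 (.inl ⟨⟨hk, trivial⟩, fun h => hu (ancestors_mono Set.subset_union_left h)⟩)
    | bidir =>
      by_contra hu
      exact ho.1 (.inl ⟨⟨hk, trivial⟩, fun h => hu (ancestors_mono Set.subset_union_left h)⟩)

/-- A node whose addition to the conditioning set blocks an open walk is an ancestor of the
conditioning set or of an end of the walk. -/
lemma mem_ancestors_of_blocks {S : Set N} {X V u v : N} (p : G.Walk u v) :
    ∀ u₀ k₀, (k₀ = .bwd → u ∈ G.ancestors (S ∪ {V})) → ¬ p.InteriorBlockedAfter S u₀ k₀ →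
      p.InteriorBlockedAfter (S ∪ {X}) u₀ k₀ →
      X ∈ G.ancestors (S ∪ {V}) ∨ X ∈ G.ancestors (S ∪ {v}) := by
  induction p with
  | nil => exact fun _ _ _ _ h => h.elim
  | @cons u w v k h p ih =>
    intro u₀ k₀ hV ho hb
    rw [interiorBlockedAfter_cons, not_or] at ho
    rcases hb with hb | hb
    · rcases hb with ⟨hc, hu⟩ | ⟨hc, hu, hout⟩
      · exact (ho.1 (.inl ⟨hc, fun h => hu (ancestors_mono Set.subset_union_left h)⟩)).elim
      · have huX : u = X := hu.resolve_left fun hu => ho.1 (.inr ⟨hc, hu, hout⟩)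
        subst huX
        rcases hout with ⟨rfl, -⟩ | ⟨rfl, -⟩
        · exact .inl (hV rfl)
        · exact .inr ((isAncestor_of_dir h).mem_ancestors
            (mem_ancestors_of_headAtEnd p _ .fwd trivial ho.2))
    · refine ih _ _ ?_ ho.2 hb
      -- Behind a backward edge the invariant `hV` persists: either `u` was itself reached
      -- backwards, or it is an open collider and hence an ancestor of `S`.
      rintro rfl
      refine (isAncestor_of_dir h).mem_ancestors ?_
      by_cases hk : k₀ = .bwd
      · exact hV hk
      · by_contra hu
        exact ho.1 (.inl ⟨⟨by cases k₀ <;> simp_all [EdgeKind.HeadAtEnd], trivial⟩,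
          fun h => hu (ancestors_mono Set.subset_union_left h)⟩)

end Walk

/-- The graphical content of an extended Y-structure. -/
theorem extended_y_structure {V W X Y : N} {S : Set N}
    (hVX : V ≠ X) (hWX : W ≠ X) (hXY : X ≠ Y) (hVS : V ∉ S) (hWS : W ∉ S)
    (hYS : Y ∉ S)
    (hVY : G.SigmaSep V Y (S ∪ {X})) (hVY' : ¬ G.SigmaSep V Y S)
    (hVW' : ¬ G.SigmaSep V W (S ∪ {X})) (hVW : G.SigmaSep V W S) :
    G.IsAncestor X Y ∧
      ¬ Relation.ReflTransGen (G.MoralStep (G.ancestors (S ∪ {X} ∪ {Y})) (S ∪ {X})) X Y := by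
  have hVC : V ∉ S ∪ {X} := fun h => h.elim hVS hVX
  have hYC : Y ∉ S ∪ {X} := fun h => h.elim hYS hXY.symm
  simp only [SigmaSep, Walk.SigmaBlocked, not_forall, not_or] at hVY' hVW'
  obtain ⟨p, -, -, -, hp⟩ := hVY'
  obtain ⟨q, -, -, -, hq⟩ := hVW'
  have hq' := hVW.interiorBlocked hVS hWS q
  have hp' := hVY.interiorBlocked hVC hYC p
  cases q with
  | nil => exact hq'.elim
  | @cons _ a _ kq eq q =>
    cases p with
    | nil => exact hp'.elim
    | @cons _ b _ kp ep p =>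
      constructor
      · obtain ⟨k, hkX, hkS, hk⟩ :=
          (Walk.exists_last_collider q _ _ hq).resolve_left (not_not.2 hq')
        have hXS : X ∉ G.ancestors S := fun h => hkS (hkX.mem_ancestors h)
        have hXV : ¬ G.IsAncestor X V := by
          intro hXV
          obtain ⟨r, hr⟩ := Walk.exists_prepend_directed (hkX.trans hXV) hkS hk
          exact hr (hVW.interiorBlocked hVS hWS r)
        have := Walk.mem_ancestors_of_blocks (V := V) p V kp ?_ hp hp'
        · simp only [ancestors_insert] at this
          rcases this with (h | h) | (h | h)
          exacts [(hXS h).elim, (hXV h).elim, (hXS h).elim, h]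
        · rintro rfl
          exact ⟨V, .inr rfl, isAncestor_of_dir ep⟩
      · intro hc
        have hA : ∀ i ∈ G.ancestors (S ∪ {X} ∪ {Y}), i ∈ G.ancestors (S ∪ {X}) ∨
            G.IsAncestor i Y ∨ (i ∉ G.ancestors (S ∪ {X}) →
              (∃ p : G.Walk i Y, ∀ u₀, ¬ p.InteriorBlockedAfter (S ∪ {X}) u₀ .bwd) → False) := by
          intro i hi
          rw [ancestors_insert] at hi
          exact hi.imp_right .inl
        -- Here `X` is in the conditioning set, so the walk obtained is open only when entered
        -- through an arrowhead; the graft enters it that way.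
        obtain ⟨r, hr⟩ := (exists_walk_of_moralChain hA hc).resolve_left id
        obtain ⟨t, ht⟩ := Walk.exists_graft ⟨r, fun u₀ k₀ h => hr u₀ k₀ (.inl h)⟩ q _ _ hq hq'
        exact ht (hVY.interiorBlocked hVC hYC (.cons kq eq t))

end DMG

/-! ### Calculus of conditional independence of σ-algebras. -/

namespace ProbabilityTheory

section CondIndepSup

set_option linter.unusedSectionVars false

variable {Ω : Type*} {H F₁ F₂ Z : MeasurableSpace Ω} {mΩ : MeasurableSpace Ω}
  [StandardBorelSpace Ω] {μ : Measure Ω} [IsFiniteMeasure μ]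

lemma condExp_inter_indicator {s t : Set Ω} (hs : MeasurableSet[H] s)
    (ht : MeasurableSet[mΩ] t) :
    μ⟦s ∩ t | H⟧ =ᵐ[μ] s.indicator (μ⟦t | H⟧) := by
  have : (s ∩ t).indicator (fun _ => (1 : ℝ)) = s.indicator (t.indicator fun _ => 1) := by
    rw [Set.indicator_indicator]
  rw [this]
  exact condExp_indicator ((integrable_const 1).indicator ht) hs

/-- Intersections of events of `F₁` and of `H` form a π-system generating `F₁ ⊔ H`, and indicators
of events of `H` can be pulled out of the conditional expectation. -/
lemma CondIndep.sup_left {hH : H ≤ mΩ} (h₁ : F₁ ≤ mΩ) (h₂ : F₂ ≤ mΩ)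
    (h : CondIndep H F₁ F₂ hH μ) : CondIndep H (F₁ ⊔ H) F₂ hH μ := by
  have hgen : F₁ ⊔ H = MeasurableSpace.generateFrom
      (Set.image2 (· ∩ ·) {s | MeasurableSet[F₁] s} {s | MeasurableSet[H] s}) := by
    apply le_antisymm
    · refine sup_le (fun s hs => ?_) fun s hs => ?_
      · exact MeasurableSpace.measurableSet_generateFrom
          ⟨s, hs, Set.univ, MeasurableSet.univ, Set.inter_univ s⟩
      · exact MeasurableSpace.measurableSet_generateFrom
          ⟨Set.univ, MeasurableSet.univ, s, hs, Set.univ_inter s⟩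
    · refine MeasurableSpace.generateFrom_le ?_
      rintro _ ⟨s, hs, t, ht, rfl⟩
      exact MeasurableSet.inter (le_sup_left (a := F₁) (b := H) s hs)
        (le_sup_right (a := F₁) (b := H) t ht)
  refine CondIndepSets.condIndep (hm' := hH) (sup_le h₁ hH) h₂ (p1 := _)
    (p2 := {s | MeasurableSet[F₂] s}) ?_ (@MeasurableSpace.isPiSystem_measurableSet Ω F₂) hgen
    (@MeasurableSpace.generateFrom_measurableSet Ω F₂).symm ?_
  · rintro _ ⟨s, hs, t, ht, rfl⟩ _ ⟨s', hs', t', ht', rfl⟩ -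
    exact ⟨s ∩ s', MeasurableSet.inter hs hs', t ∩ t', MeasurableSet.inter ht ht',
      Set.inter_inter_inter_comm _ _ _ _⟩
  · rw [condIndepSets_iff _ hH]
    · rintro _ t ⟨s, hs, u, hu, rfl⟩ ht
      have h1 := (condIndep_iff _ _ _ hH h₁ h₂ μ).1 h s t hs ht
      have h2 := condExp_inter_indicator (μ := μ) hu ((h₁ s hs).inter (h₂ t ht))
      have h3 := condExp_inter_indicator (μ := μ) hu (h₁ s hs)
      have e : s ∩ u = u ∩ s := Set.inter_comm s u
      simp only [e, Set.inter_assoc]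
      filter_upwards [h1, h2, h3] with ω h1 h2 h3
      rw [h2, Pi.mul_apply, h3]
      by_cases hω : ω ∈ u <;> simp [hω, h1]
    · rintro _ ⟨s, hs, u, hu, rfl⟩
      exact (h₁ s hs).inter (hH u hu)
    · exact fun s hs => h₂ s hs

/-- In this form, enlarging the conditioning σ-algebra is a matter of the tower property. -/
lemma condIndep_iff_condExp_sup {hH : H ≤ mΩ} (h₁ : F₁ ≤ mΩ) (h₂ : F₂ ≤ mΩ) :
    CondIndep H F₁ F₂ hH μ ↔
      ∀ t, MeasurableSet[F₂] t → μ⟦t | F₁ ⊔ H⟧ =ᵐ[μ] μ⟦t | H⟧ := by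
  have hle : F₁ ⊔ H ≤ mΩ := sup_le h₁ hH
  have hint : ∀ t, MeasurableSet[mΩ] t → Integrable (t.indicator fun _ => (1 : ℝ)) μ :=
    fun t ht => (integrable_const 1).indicator ht
  have key : ∀ s t, MeasurableSet[mΩ] s → MeasurableSet[mΩ] t →
      μ[s.indicator (μ⟦t | H⟧) | H] =ᵐ[μ] μ⟦s | H⟧ * μ⟦t | H⟧ := by
    intro s t hs ht
    have : s.indicator (μ⟦t | H⟧) = s.indicator (fun _ => (1 : ℝ)) * μ⟦t | H⟧ := by
      ext ω
      by_cases hω : ω ∈ s <;> simp [hω]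
    rw [this]
    refine condExp_mul_of_stronglyMeasurable_right stronglyMeasurable_condExp ?_ (hint s hs)
    rw [← this]
    exact integrable_condExp.indicator hs
  constructor
  · intro h t ht
    have h' := (condIndep_iff _ _ _ hH hle h₂ μ).1 (h.sup_left h₁ h₂)
    refine (ae_eq_condExp_of_forall_setIntegral_eq hle (hint t (h₂ t ht))
      (fun s _ _ => integrable_condExp.integrableOn) (fun s hs _ => ?_)
      (StronglyMeasurable.aestronglyMeasurable (m := F₁ ⊔ H)
        (stronglyMeasurable_condExp.mono le_sup_right))).symm
    rw [← integral_indicator (hle s hs), ← integral_indicator (hle s hs),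
      Set.indicator_indicator, ← integral_condExp hH (f := s.indicator (μ⟦t | H⟧)),
      ← integral_condExp hH (f := (s ∩ t).indicator fun _ => (1 : ℝ))]
    exact integral_congr_ae ((key s t (hle s hs) (h₂ t ht)).trans (h' s t hs ht).symm)
  · intro h
    refine (condIndep_iff _ _ _ hH h₁ h₂ μ).2 fun s t hs ht => ?_
    have h1 : μ⟦s ∩ t | F₁ ⊔ H⟧ =ᵐ[μ] s.indicator (μ⟦t | H⟧) := by
      refine (condExp_inter_indicator (le_sup_left (a := F₁) (b := H) s hs) (h₂ t ht)).trans ?_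
      filter_upwards [h t ht] with ω hω
      by_cases hs : ω ∈ s <;> simp [hs, hω]
    have h2 : μ[μ⟦s ∩ t | F₁ ⊔ H⟧ | H] =ᵐ[μ] μ⟦s ∩ t | H⟧ :=
      condExp_condExp_of_le le_sup_right hle
    exact h2.symm.trans ((condExp_congr_ae h1).trans (key s t (h₁ s hs) (h₂ t ht)))

/-- Conditional independence is preserved when the conditioning σ-algebra is enlarged by events
that are determined by it together with one of the two sides. -/
lemma CondIndep.sup_cond_left {hH : H ≤ mΩ} (h₁ : F₁ ≤ mΩ) (h₂ : F₂ ≤ mΩ)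
    (h : CondIndep H F₁ F₂ hH μ) (hZ : Z ≤ F₁ ⊔ H) (hHZ : H ⊔ Z ≤ mΩ) :
    CondIndep (H ⊔ Z) F₁ F₂ hHZ μ := by
  rw [condIndep_iff_condExp_sup h₁ h₂] at h ⊢
  intro t ht
  -- `H ⊔ Z` lies between `H` and `F₁ ⊔ H`, whose conditional probabilities of `t` agree, so the
  -- intermediate one agrees with both.
  have e : F₁ ⊔ (H ⊔ Z) = F₁ ⊔ H :=
    le_antisymm (sup_le le_sup_left (sup_le le_sup_right hZ))
      (sup_le_sup_left le_sup_left _)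
  have hle : F₁ ⊔ H ≤ mΩ := sup_le h₁ hH
  have h1 : μ[μ⟦t | F₁ ⊔ H⟧ | H ⊔ Z] =ᵐ[μ] μ⟦t | H ⊔ Z⟧ :=
    condExp_condExp_of_le (sup_le le_sup_right hZ) hle
  have h2 : μ[μ⟦t | H⟧ | H ⊔ Z] = μ⟦t | H⟧ :=
    condExp_of_stronglyMeasurable hHZ (stronglyMeasurable_condExp.mono le_sup_left)
      integrable_condExp
  rw [e]
  refine (h t ht).trans ?_
  rw [← h2]
  exact (condExp_congr_ae (h t ht).symm).trans h1

lemma CondIndep.sup_cond_right {hH : H ≤ mΩ} (h₁ : F₁ ≤ mΩ) (h₂ : F₂ ≤ mΩ)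
    (h : CondIndep H F₁ F₂ hH μ) (hZ : Z ≤ F₂ ⊔ H) (hHZ : H ⊔ Z ≤ mΩ) :
    CondIndep (H ⊔ Z) F₁ F₂ hHZ μ :=
  (h.symm.sup_cond_left h₂ h₁ hZ hHZ).symm

lemma CondIndep.sup_right {hH : H ≤ mΩ} (h₁ : F₁ ≤ mΩ) (h₂ : F₂ ≤ mΩ)
    (h : CondIndep H F₁ F₂ hH μ) : CondIndep H F₁ (F₂ ⊔ H) hH μ :=
  (h.symm.sup_left h₂ h₁).symm

lemma CondIndep.congr_cond {H' : MeasurableSpace Ω} {hH : H ≤ mΩ} {hH' : H' ≤ mΩ} (e : H = H')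
    (h : CondIndep H F₁ F₂ hH μ) : CondIndep H' F₁ F₂ hH' μ := by
  subst e
  exact h

lemma Indep.condIndep_bot [IsProbabilityMeasure μ] (h₁ : F₁ ≤ mΩ) (h₂ : F₂ ≤ mΩ)
    (h : Indep F₁ F₂ μ) : CondIndep ⊥ F₁ F₂ bot_le μ := by
  refine (condIndep_iff _ _ _ bot_le h₁ h₂ μ).2 fun s t hs ht => .of_forall fun ω => ?_
  have := (Indep_iff F₁ F₂ μ).1 h s t hs ht
  simp only [condExp_bot, Pi.mul_apply]
  rw [integral_indicator_const _ ((h₁ s hs).inter (h₂ t ht)), integral_indicator_const _ (h₁ s hs),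
    integral_indicator_const _ (h₂ t ht)]
  simp [measureReal_def, this]

end CondIndepSup

end ProbabilityTheory

/-! ### The Markov property by colouring components. -/

namespace DMG

variable {I J : Type*} {G : DMG I}

lemma SameSCC.symm {u v : I} (h : G.SameSCC u v) : G.SameSCC v u := ⟨h.2, h.1⟩

lemma SameSCC.trans {u v w : I} (h : G.SameSCC u v) (h' : G.SameSCC v w) : G.SameSCC u w :=
  ⟨h.1.trans h'.1, h'.2.trans h.2⟩

lemma SameSCC.refl (u : I) : G.SameSCC u u := ⟨.refl, .refl⟩

/-- The parents of the strongly connected component of `i` outside this component. -/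
def compPa (G : DMG I) (i : I) : Set I :=
  {p | ¬ G.SameSCC p i ∧ ∃ k, G.SameSCC k i ∧ G.dir p k}

/-- The exogenous parents, with respect to the parent relation `R`, of the strongly connected
component of `i`. -/
def compExo (G : DMG I) (R : J → I → Prop) (i : I) : Set J :=
  {j | ∃ k, G.SameSCC k i ∧ R j k}

/-- The number of ancestors of a node. -/
noncomputable def ancestorCount (G : DMG I) (i : I) : ℕ := {a | G.IsAncestor a i}.ncard

lemma isAncestor_of_mem_compPa {p i : I} (h : p ∈ G.compPa i) : G.IsAncestor p i :=
  let ⟨_, _, hk, hpk⟩ := h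
  (isAncestor_of_dir hpk).trans hk.1

/-- `i` is an ancestor of itself but not of `p`, so the inclusion of ancestor sets is strict. The
count thus orders the components along the acyclic condensation of the graph. -/
lemma ancestorCount_lt [Finite I] {p i : I} (h : p ∈ G.compPa i) :
    G.ancestorCount p < G.ancestorCount i := by
  have hpi := isAncestor_of_mem_compPa h
  refine Set.ncard_lt_ncard ⟨fun a ha => ha.trans hpi, fun hs => h.1 ⟨hpi, ?_⟩⟩ (Set.toFinite _)
  exact hs (show i ∈ {a | G.IsAncestor a i} from .refl)

variable {Ω : Type*} {mΩ : MeasurableSpace Ω}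

/-- The information in the exogenous σ-algebras whose colour is `s`. -/
@[reducible] def exoSide (𝓕 : J → MeasurableSpace Ω) (colJ : J → Prop) (s : Prop) : MeasurableSpace Ω :=
  ⨆ j ∈ {j | colJ j ↔ s}, 𝓕 j

lemma exoSide_le {𝓕 : J → MeasurableSpace Ω} (h : ∀ j, 𝓕 j ≤ mΩ) (colJ : J → Prop) (s : Prop) :
    exoSide 𝓕 colJ s ≤ mΩ :=
  iSup₂_le fun j _ => h j

/-- Each component of an ancestral set is determined by the exogenous variables of its own colour
and by the preceding variables in the conditioning set. -/
lemma le_exoSide_sup [Finite I] {R : J → I → Prop} {𝒢 : I → MeasurableSpace Ω}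
    {𝓕 : J → MeasurableSpace Ω}
    (hX : ∀ i, 𝒢 i ≤ (⨆ p ∈ G.compPa i, 𝒢 p) ⊔ ⨆ j ∈ G.compExo R i, 𝓕 j)
    {A C : Set I} (hA : ∀ i ∈ A, ∀ p, G.IsAncestor p i → p ∈ A)
    {col : I → Prop} {colJ : J → Prop}
    (hcol : ∀ i ∈ A, ∀ p ∈ G.compPa i, p ∉ C → (col p ↔ col i))
    (hcolJ : ∀ i ∈ A, ∀ j ∈ G.compExo R i, (colJ j ↔ col i)) (n : ℕ) :
    ∀ i ∈ A, G.ancestorCount i = n →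
      𝒢 i ≤ exoSide 𝓕 colJ (col i) ⊔ ⨆ c ∈ {c ∈ C | G.ancestorCount c < n}, 𝒢 c := by
  induction n using Nat.strong_induction_on with
  | _ n ih =>
    intro i hi hn
    refine (hX i).trans (sup_le (iSup₂_le fun p hp => ?_) (iSup₂_le fun j hj => ?_))
    · have hlt := ancestorCount_lt hp
      rw [hn] at hlt
      by_cases hpC : p ∈ C
      · exact le_sup_of_le_right (le_iSup₂_of_le p ⟨hpC, hlt⟩ le_rfl)
      · have := ih _ hlt p (hA i hi p (isAncestor_of_mem_compPa hp)) rfl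
        rw [hcol i hi p hp hpC] at this
        refine this.trans (sup_le_sup_left (iSup₂_le fun c hc => ?_) _)
        exact le_iSup₂_of_le c ⟨hc.1, hc.2.trans hlt⟩ le_rfl
    · exact le_sup_of_le_left (le_iSup₂_of_le j (hcolJ i hi j hj) le_rfl)

/-- Two sides of a colouring are conditionally independent given `C`. -/
lemma condIndep_exoSide [Finite I] [StandardBorelSpace Ω] {P : Measure Ω} [IsProbabilityMeasure P]
    {R : J → I → Prop} {𝒢 : I → MeasurableSpace Ω} {𝓕 : J → MeasurableSpace Ω}
    (h𝒢 : ∀ i, 𝒢 i ≤ mΩ) (h𝓕 : ∀ j, 𝓕 j ≤ mΩ) (hind : iIndep 𝓕 P)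
    (hX : ∀ i, 𝒢 i ≤ (⨆ p ∈ G.compPa i, 𝒢 p) ⊔ ⨆ j ∈ G.compExo R i, 𝓕 j)
    {A C : Set I} (hA : ∀ i ∈ A, ∀ p, G.IsAncestor p i → p ∈ A) (hCA : C ⊆ A)
    {col : I → Prop} {colJ : J → Prop}
    (hcol : ∀ i ∈ A, ∀ p ∈ G.compPa i, p ∉ C → (col p ↔ col i))
    (hcolJ : ∀ i ∈ A, ∀ j ∈ G.compExo R i, (colJ j ↔ col i)) :
    CondIndep (⨆ c ∈ C, 𝒢 c) (exoSide 𝓕 colJ True) (exoSide 𝓕 colJ False)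
      (iSup₂_le fun c _ => h𝒢 c) P := by
  classical
  have hle : ∀ T : Set I, (⨆ c ∈ T, 𝒢 c) ≤ mΩ := fun T => iSup₂_le fun c _ => h𝒢 c
  -- Induction over the subsets of `C` closed under smaller ancestor count: the empty set is
  -- independence of disjoint noise groups, and each new variable is determined by the noise of its
  -- own colour together with `T`.
  have key : ∀ T : Finset I, (↑T : Set I) ⊆ C →
      (∀ c ∈ T, ∀ c' ∈ C, G.ancestorCount c' < G.ancestorCount c → c' ∈ T) →
      CondIndep (⨆ c ∈ (↑T : Set I), 𝒢 c) (exoSide 𝓕 colJ True) (exoSide 𝓕 colJ False)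
        (hle _) P := by
    intro T
    induction T using Finset.induction_on_max_value G.ancestorCount with
    | empty =>
      intro _ _
      have hi : Indep (exoSide 𝓕 colJ True) (exoSide 𝓕 colJ False) P :=
        indep_iSup_of_disjoint h𝓕 hind (Set.disjoint_left.2 fun j h h' => h'.1 (h.2 trivial))
      exact (hi.condIndep_bot (exoSide_le h𝓕 _ _) (exoSide_le h𝓕 _ _)).congr_cond (by simp)
    | insert a T ha hmax ih =>
      intro hTC hdown
      have haC : a ∈ C := hTC (by simp)
      have ih := ih (fun c hc => hTC (by simpa using .inr hc)) fun c hc c' hc' hlt => by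
        rcases Finset.mem_insert.1 (hdown c (Finset.mem_insert_of_mem hc) c' hc' hlt) with h | h
        · subst h
          exact absurd (hmax c hc) (not_le.2 hlt)
        · exact h
      have hle_a : 𝒢 a ≤ exoSide 𝓕 colJ (col a) ⊔ ⨆ c ∈ (↑T : Set I), 𝒢 c := by
        refine (le_exoSide_sup hX hA hcol hcolJ _ a (hCA haC) rfl).trans
          (sup_le_sup_left (iSup₂_le fun c hc => ?_) _)
        have hcT : c ∈ T := by
          rcases Finset.mem_insert.1 (hdown a (Finset.mem_insert_self a T) c hc.1 hc.2) with h | h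
          · subst h
            exact absurd hc.2 (lt_irrefl _)
          · exact h
        exact le_iSup₂_of_le c hcT le_rfl
      have e : (⨆ c ∈ (↑T : Set I), 𝒢 c) ⊔ 𝒢 a = ⨆ c ∈ (↑(insert a T) : Set I), 𝒢 c := by
        rw [Finset.coe_insert, iSup_insert, sup_comm]
      by_cases hcola : col a
      · rw [show col a = True from eq_true hcola] at hle_a
        exact (ih.sup_cond_left (exoSide_le h𝓕 _ _) (exoSide_le h𝓕 _ _) hle_a
          (sup_le (hle _) (h𝒢 a))).congr_cond e
      · rw [show col a = False from eq_false hcola] at hle_a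
        exact (ih.sup_cond_right (exoSide_le h𝓕 _ _) (exoSide_le h𝓕 _ _) hle_a
          (sup_le (hle _) (h𝒢 a))).congr_cond e
  have := key C.toFinite.toFinset (by simp) (by simp +contextual)
  exact this.congr_cond (by simp)

/-- A directed path from `i` to `k` never leaves their component, so its edges are admissible steps
even out of nodes of `C`. Colours defined by chains are therefore constant on components. -/
lemma moralChain_of_isAncestor {A C : Set I} (hA : ∀ i ∈ A, ∀ p, G.IsAncestor p i → p ∈ A)
    {i k : I} (hk : k ∈ A) (h : G.SameSCC i k) :
    Relation.ReflTransGen (G.MoralStep A C) i k := by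
  have key : ∀ c, G.IsAncestor i c → G.IsAncestor c k →
      Relation.ReflTransGen (G.MoralStep A C) i c := by
    intro c hic
    induction hic with
    | refl => exact fun _ => .refl
    | @tail b c hib hbc ih =>
      intro hck
      have hbk : G.IsAncestor b k := (isAncestor_of_dir hbc).trans hck
      exact (ih hbk).tail ⟨hA k hk b hbk, hA k hk c hck,
        .inl ⟨hbc, .inr ⟨isAncestor_of_dir hbc, hck.trans (h.2.trans hib)⟩⟩⟩
  exact key k h.1 .refl

/-- The Markov property: without a chain from `a` to `b`, the variable `b` is conditionally
independent given `C` of `a` and of the exogenous parents of `a`. -/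
theorem condIndep_of_not_moralChain [Finite I] [StandardBorelSpace Ω] {P : Measure Ω}
    [IsProbabilityMeasure P] {R : J → I → Prop} {𝒢 : I → MeasurableSpace Ω}
    {𝓕 : J → MeasurableSpace Ω}
    (hR : ∀ j i k, R j i → R j k → i ≠ k → G.bi i k)
    (h𝒢 : ∀ i, 𝒢 i ≤ mΩ) (h𝓕 : ∀ j, 𝓕 j ≤ mΩ) (hind : iIndep 𝓕 P)
    (hX : ∀ i, 𝒢 i ≤ (⨆ p ∈ G.compPa i, 𝒢 p) ⊔ ⨆ j ∈ G.compExo R i, 𝓕 j)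
    {A C : Set I} (hA : ∀ i ∈ A, ∀ p, G.IsAncestor p i → p ∈ A) (hCA : C ⊆ A)
    {a b : I} (ha : a ∈ A) (hb : b ∈ A)
    (hab : ¬ Relation.ReflTransGen (G.MoralStep A C) a b) :
    CondIndep (⨆ c ∈ C, 𝒢 c) (𝒢 a ⊔ ⨆ j ∈ {j | R j a}, 𝓕 j) (𝒢 b)
      (iSup₂_le fun c _ => h𝒢 c) P := by
  set col : I → Prop := Relation.ReflTransGen (G.MoralStep A C) a with hcoldef
  set colJ : J → Prop := fun j => ∃ i ∈ A, R j i ∧ col i with hcolJdef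
  have hscc : ∀ i ∈ A, ∀ k, G.SameSCC k i → k ∈ A ∧ (col k ↔ col i) := by
    intro i hi k hk
    have hkA := hA i hi k hk.1
    exact ⟨hkA, fun h => h.trans (moralChain_of_isAncestor hA hi hk),
      fun h => h.trans (moralChain_of_isAncestor hA hkA hk.symm)⟩
  have hcol : ∀ i ∈ A, ∀ p ∈ G.compPa i, p ∉ C → (col p ↔ col i) := by
    rintro i hi p hp hpC
    have hpA := hA i hi p (isAncestor_of_mem_compPa hp)
    obtain ⟨-, k, hk, hpk⟩ := hp
    obtain ⟨hkA, hki⟩ := hscc i hi k hk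
    rw [← hki]
    exact ⟨fun h => h.tail ⟨hpA, hkA, .inl ⟨hpk, .inl hpC⟩⟩,
      fun h => h.tail ⟨hkA, hpA, .inr (.inl ⟨hpk, hpC⟩)⟩⟩
  have hcolJ : ∀ i ∈ A, ∀ j ∈ G.compExo R i, (colJ j ↔ col i) := by
    rintro i hi j ⟨k, hk, hjk⟩
    obtain ⟨hkA, hki⟩ := hscc i hi k hk
    rw [← hki]
    refine ⟨?_, fun h => ⟨k, hkA, hjk, h⟩⟩
    rintro ⟨i', hi', hji', hci'⟩
    by_cases e : i' = k
    · exact e ▸ hci'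
    · exact hci'.tail ⟨hi', hkA, .inr (.inr (hR j i' k hji' hjk e))⟩
  have hmain := condIndep_exoSide h𝒢 h𝓕 hind hX hA hCA hcol hcolJ
  have hcola : col a := .refl
  have hle := fun i hi => le_exoSide_sup hX hA hcol hcolJ _ i hi rfl
  have hmono : ∀ n : ℕ, (⨆ c ∈ {c ∈ C | G.ancestorCount c < n}, 𝒢 c) ≤ ⨆ c ∈ C, 𝒢 c :=
    fun n => iSup₂_le fun c hc => le_iSup₂_of_le c hc.1 le_rfl
  have h1 := exoSide_le h𝓕 colJ True
  have h2 := exoSide_le h𝓕 colJ False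
  have hH : (⨆ c ∈ C, 𝒢 c) ≤ mΩ := iSup₂_le fun c _ => h𝒢 c
  -- Joined with the conditioning σ-algebra, each side contains the variables in `A` of its colour.
  have hfin := (hmain.sup_left h1 h2).sup_right (sup_le h1 hH) h2
  refine condIndep_of_condIndep_of_le_left (condIndep_of_condIndep_of_le_right hfin ?_)
    (sup_le ?_ ?_)
  · have := hle b hb
    rw [show col b = False from eq_false hab] at this
    exact this.trans (sup_le_sup_left (hmono _) _)
  · have := hle a ha
    rw [show col a = True from eq_true hcola] at this
    exact this.trans (sup_le_sup_left (hmono _) _)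
  · refine iSup₂_le fun j hj => le_sup_of_le_left (le_iSup₂_of_le j ?_ le_rfl)
    exact ⟨fun _ => trivial, fun _ => ⟨a, ha, hj, hcola⟩⟩

end DMG

/-! ### From σ-algebras to random variables solving structural equations. -/

namespace ProbabilityTheory

/-- Adding one independent σ-algebra to an independent family. -/
lemma iIndep_option {Ω J : Type*} {mΩ : MeasurableSpace Ω} {P : Measure Ω}
    {𝓕 : Option J → MeasurableSpace Ω} (hsome : iIndep (fun j => 𝓕 (some j)) P)
    (hnone : Indep (𝓕 none) (⨆ j, 𝓕 (some j)) P) : iIndep 𝓕 P := by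
  classical
  have hP : IsProbabilityMeasure P := hsome.isProbabilityMeasure
  rw [iIndep_iff]
  intro s f hf
  have hB : MeasurableSet[⨆ j, 𝓕 (some j)] (⋂ j ∈ s.eraseNone, f (some j)) := by
    refine Finset.measurableSet_biInter _ fun j hj => ?_
    exact le_iSup (fun j => 𝓕 (some j)) j _ (hf _ (Finset.mem_eraseNone.1 hj))
  have hPB : P (⋂ j ∈ s.eraseNone, f (some j)) = ∏ j ∈ s.eraseNone, P (f (some j)) :=
    (iIndep_iff _ _).1 hsome s.eraseNone (f := fun j => f (some j))
      fun j hj => hf _ (Finset.mem_eraseNone.1 hj)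
  have hmap : ∏ j ∈ s.eraseNone, P (f (some j)) = ∏ i ∈ s.erase none, P (f i) := by
    rw [← Finset.map_some_eraseNone, Finset.prod_map]
    rfl
  have hinter : ⋂ i ∈ s.erase none, f i = ⋂ j ∈ s.eraseNone, f (some j) := by
    ext ω
    simp [Option.forall]
  by_cases hn : none ∈ s
  · rw [← Finset.insert_erase hn, Finset.set_biInter_insert,
      Finset.prod_insert (Finset.notMem_erase _ _), hinter,
      (Indep_iff _ _ P).1 hnone _ _ (hf none hn) hB, hPB, hmap]
  · rw [← Finset.erase_eq_of_notMem hn, hinter, hPB, hmap]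

/-- Conditional independence only depends on the joint law. -/
lemma CondIndepFun.of_map_eq {Ω Ω' α β γ : Type*} {mΩ : MeasurableSpace Ω}
    [StandardBorelSpace Ω] {mΩ' : MeasurableSpace Ω'} [StandardBorelSpace Ω']
    [MeasurableSpace α] [StandardBorelSpace α] [Nonempty α]
    [MeasurableSpace β] [StandardBorelSpace β] [Nonempty β] [MeasurableSpace γ]
    {P : Measure Ω} [IsFiniteMeasure P] {P' : Measure Ω'} [IsFiniteMeasure P']
    {f : Ω → α} {g : Ω → β} {k : Ω → γ} {f' : Ω' → α} {g' : Ω' → β} {k' : Ω' → γ}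
    (hf : Measurable f) (hg : Measurable g) (hk : Measurable k)
    (hf' : Measurable f') (hg' : Measurable g') (hk' : Measurable k')
    (e : P.map (fun ω => (k ω, f ω, g ω)) = P'.map (fun ω => (k' ω, f' ω, g' ω)))
    (h : CondIndepFun (MeasurableSpace.comap k inferInstance) hk.comap_le f g P) :
    CondIndepFun (MeasurableSpace.comap k' inferInstance) hk'.comap_le f' g' P' := by
  rw [condIndepFun_iff_map_prod_eq_prod_condDistrib_prod_condDistrib hf hg hk] at h
  rw [condIndepFun_iff_map_prod_eq_prod_condDistrib_prod_condDistrib hf' hg' hk']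
  have ek : P.map k = P'.map k' := by
    have := congrArg (Measure.map Prod.fst) e
    rwa [Measure.map_map (by fun_prop) (by fun_prop),
      Measure.map_map (by fun_prop) (by fun_prop)] at this
  have ef : P.map (fun ω => (k ω, f ω)) = P'.map (fun ω => (k' ω, f' ω)) := by
    have := congrArg (Measure.map fun z : γ × α × β => (z.1, z.2.1)) e
    rwa [Measure.map_map (by fun_prop) (by fun_prop),
      Measure.map_map (by fun_prop) (by fun_prop)] at this
  have eg : P.map (fun ω => (k ω, g ω)) = P'.map (fun ω => (k' ω, g' ω)) := by
    have := congrArg (Measure.map fun z : γ × α × β => (z.1, z.2.2)) e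
    rwa [Measure.map_map (by fun_prop) (by fun_prop),
      Measure.map_map (by fun_prop) (by fun_prop)] at this
  have e1 : condDistrib f k P = condDistrib f' k' P' := by
    simp only [condDistrib_def, ef]
  have e2 : condDistrib g k P = condDistrib g' k' P' := by
    simp only [condDistrib_def, eg]
  rw [← e, h, ek, e1, e2]

/-- A property that holds almost surely holds surely after composition with a measurable map
that is almost surely the identity. -/
lemma exists_retract {Ω : Type*} {mΩ : MeasurableSpace Ω} {P : Measure Ω}
    [IsProbabilityMeasure P] {p : Ω → Prop} (h : ∀ᵐ ω ∂P, p ω) :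
    ∃ r : Ω → Ω, Measurable r ∧ r =ᵐ[P] id ∧ ∀ ω, p (r ω) := by
  classical
  set N := toMeasurable P {ω | ¬ p ω} with hN
  have hN0 : P N = 0 := by rw [hN, measure_toMeasurable]; exact h
  have hNp : ∀ ω ∉ N, p ω := fun ω hω => by
    by_contra hp
    exact hω (subset_toMeasurable P _ hp)
  have hne : ∃ ω₀, ω₀ ∉ N := by
    by_contra! hall
    have : N = Set.univ := Set.eq_univ_of_forall hall
    rw [this, measure_univ] at hN0
    exact one_ne_zero hN0
  obtain ⟨ω₀, hω₀⟩ := hne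
  refine ⟨fun ω => if ω ∈ N then ω₀ else ω,
    Measurable.ite (measurableSet_toMeasurable _ _) measurable_const measurable_id, ?_, ?_⟩
  · have : ∀ᵐ ω ∂P, ω ∉ N := measure_eq_zero_iff_ae_notMem.1 hN0
    filter_upwards [this] with ω hω
    simp [hω]
  · intro ω
    by_cases hω : ω ∈ N
    · simpa [hω] using hNp _ hω₀
    · simpa [hω] using hNp _ hω

end ProbabilityTheory

namespace DMG

open scoped Classical in
/-- The Markov property for solutions of structural equations that are solved for the strongly
connected components of the graph. The exogenous variable `T` only acts on `a`. -/
theorem condIndepFun_of_equations {I J : Type*} [Finite I] [Fintype J]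
    {𝒳 : I → Type*} {ℰ : J → Type*} {𝒯 Ω : Type*}
    [∀ i, MeasurableSpace (𝒳 i)] [∀ i, StandardBorelSpace (𝒳 i)]
    [∀ j, MeasurableSpace (ℰ j)] [MeasurableSpace 𝒯] [StandardBorelSpace 𝒯]
    [mΩ : MeasurableSpace Ω] [StandardBorelSpace Ω]
    {G : DMG I} {R : J → I → Prop} (hR : ∀ j i k, R j i → R j k → i ≠ k → G.bi i k)
    {P : Measure Ω} [IsProbabilityMeasure P]
    {X : Ω → ∀ i, 𝒳 i} {E : Ω → ∀ j, ℰ j} {T : Ω → 𝒯}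
    (hXm : Measurable X) (hEm : Measurable E) (hTm : Measurable T)
    {noise : ∀ j, Measure (ℰ j)} [∀ j, IsProbabilityMeasure (noise j)]
    {τ : Measure 𝒯} [IsProbabilityMeasure τ]
    (hlaw : P.map (fun ω => (T ω, E ω)) = τ.prod (Measure.pi noise))
    {a b : I} {A C : Set I}
    (Φ : ∀ i, (∀ i, 𝒳 i) × (∀ j, ℰ j) × 𝒯 → 𝒳 i) (hΦ : ∀ i, Measurable (Φ i))
    (hdep : ∀ i x x' e e' t t', (∀ p ∈ G.compPa i, x p = x' p) →
      (∀ j ∈ G.compExo R i, e j = e' j) → (G.SameSCC a i → t = t') →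
      Φ i (x, e, t) = Φ i (x', e', t'))
    (heq : ∀ᵐ ω ∂P, ∀ i, X ω i = Φ i (X ω, E ω, T ω))
    (hA : ∀ i ∈ A, ∀ p, G.IsAncestor p i → p ∈ A) (hCA : C ⊆ A)
    (ha : a ∈ A) (hb : b ∈ A)
    (hab : ¬ Relation.ReflTransGen (G.MoralStep A C) a b)
    (hCm : Measurable fun ω => C.domRestrict (X ω)) :
    CondIndepFun (MeasurableSpace.comap (fun ω => C.domRestrict (X ω)) inferInstance)
      hCm.comap_le (fun ω => (X ω a, T ω)) (fun ω => X ω b) P := by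
  -- Inclusions of generated σ-algebras need the equations for every ω, not just almost every one.
  obtain ⟨r, hr, hrid, hreq⟩ := exists_retract heq
  obtain ⟨ω₀⟩ : Nonempty Ω := nonempty_of_isProbabilityMeasure P
  have : Nonempty (𝒳 a × 𝒯) := ⟨X ω₀ a, T ω₀⟩
  have : Nonempty (𝒳 b) := ⟨X ω₀ b⟩
  -- `T` becomes an additional noise variable `none` whose only child is `a`; having one child, it
  -- creates no bidirected edge.
  set R' : Option J → I → Prop := fun o i => o.elim (i = a) fun j => R j i with hR'
  set 𝒢 : I → MeasurableSpace Ω := fun i =>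
    MeasurableSpace.comap (fun ω => X (r ω) i) inferInstance with h𝒢
  set 𝓕 : Option J → MeasurableSpace Ω := fun o => o.elim
    (MeasurableSpace.comap (fun ω => T (r ω)) inferInstance)
    fun j => MeasurableSpace.comap (fun ω => E (r ω) j) inferInstance with h𝓕
  have hXi : ∀ i, Measurable fun ω => X (r ω) i := fun i => by fun_prop
  have hEj : ∀ j, Measurable fun ω => E (r ω) j := fun j => by fun_prop
  have hTr : Measurable fun ω => T (r ω) := by fun_prop
  have hEr : Measurable fun ω => E (r ω) := by fun_prop
  have hlaw' : P.map (fun ω => (T (r ω), E (r ω))) = τ.prod (Measure.pi noise) := by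
    rw [← hlaw]
    refine Measure.map_congr ?_
    filter_upwards [hrid] with ω hω
    simp [hω]
  have hlawT : P.map (fun ω => T (r ω)) = τ := by
    have := congrArg (Measure.map Prod.fst) hlaw'
    rw [Measure.map_map (by fun_prop) (by fun_prop)] at this
    simpa [Function.comp_def, Measure.map_fst_prod] using this
  have hlawE : P.map (fun ω => E (r ω)) = Measure.pi noise := by
    have := congrArg (Measure.map Prod.snd) hlaw'
    rw [Measure.map_map (by fun_prop) (by fun_prop)] at this
    simpa [Function.comp_def, Measure.map_snd_prod] using this
  have hlawj : ∀ j, P.map (fun ω => E (r ω) j) = noise j := by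
    intro j
    have := congrArg (Measure.map (Function.eval j)) hlawE
    rw [Measure.map_map (by fun_prop) (by fun_prop)] at this
    rw [Measure.pi_map_eval] at this
    simpa [Function.comp_def] using this
  have hindE : iIndepFun (fun j ω => E (r ω) j) P := by
    rw [iIndepFun_iff_map_fun_eq_pi_map (by fun_prop)]
    simp only [hlawj]
    exact hlawE
  have hindT : IndepFun (fun ω => T (r ω)) (fun ω => E (r ω)) P := by
    rw [indepFun_iff_map_prod_eq_prod_map_map (by fun_prop) (by fun_prop), hlaw', hlawT, hlawE]
  have hind : iIndep 𝓕 P := by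
    refine iIndep_option ?_ ?_
    · exact (iIndepFun_iff_iIndep _ _ _).1 hindE
    · have := (IndepFun_iff_Indep _ _ _).1 hindT
      rw [MeasurableSpace.comap_process_pi (fun j ω => E (r ω) j)] at this
      exact this
  have hmain := condIndep_of_not_moralChain (P := P) (R := R') (𝒢 := 𝒢) (𝓕 := 𝓕) ?_
    (fun i => (hXi i).comap_le) ?_ hind ?_ hA hCA ha hb hab
  · have hres : (⨆ c ∈ C, 𝒢 c) =
        MeasurableSpace.comap (fun ω => C.domRestrict (X (r ω))) inferInstance := by
      rw [iSup_subtype']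
      exact (MeasurableSpace.comap_process_pi (fun (c : ↥C) ω => X (r ω) c)).symm
    have hCr : Measurable fun ω => C.domRestrict (X (r ω)) := hCm.comp hr
    have h1 : CondIndepFun (MeasurableSpace.comap (fun ω => C.domRestrict (X (r ω))) inferInstance)
        hCr.comap_le (fun ω => (X (r ω) a, T (r ω))) (fun ω => X (r ω) b) P := by
      rw [condIndepFun_iff_condIndep]
      refine condIndep_of_condIndep_of_le_left (hmain.congr_cond hres) ?_
      refine (MeasurableSpace.comap_prodMk (fun ω => X (r ω) a) fun ω => T (r ω)).trans_le ?_
      refine sup_le le_sup_left (le_sup_of_le_right ?_)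
      exact le_iSup₂_of_le (none : Option J) (show a = a from rfl) le_rfl
    refine h1.of_map_eq ((hXi a).prodMk hTr) (hXi b) hCr (by fun_prop) (by fun_prop) hCm ?_
    refine Measure.map_congr ?_
    filter_upwards [hrid] with ω hω
    simp [hω]
  · rintro (_ | j) i k hi hk hik
    · exact absurd (Eq.trans hi (Eq.symm hk)) hik
    · exact hR j i k hi hk hik
  · rintro (_ | j)
    · exact hTr.comap_le
    · exact (hEj j).comap_le
  · intro i
    set m := (⨆ p ∈ G.compPa i, 𝒢 p) ⊔ ⨆ j ∈ G.compExo R' i, 𝓕 j with hm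
    -- Arguments that `Φ i` ignores are frozen at their values at `ω₀`, so that what remains is
    -- measurable for `m`.
    have hx : Measurable[m] fun ω l => if l ∈ G.compPa i then X (r ω) l else X ω₀ l := by
      refine measurable_pi_iff.2 fun l => ?_
      by_cases hl : l ∈ G.compPa i
      · simp only [hl, if_true]
        exact Measurable.of_comap_le (le_sup_of_le_left (le_iSup₂_of_le l hl le_rfl))
      · simp only [hl, if_false]
        exact measurable_const
    have he : Measurable[m] fun ω j => if j ∈ G.compExo R i then E (r ω) j else E ω₀ j := by
      refine measurable_pi_iff.2 fun j => ?_
      by_cases hj : j ∈ G.compExo R i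
      · simp only [hj, if_true]
        refine Measurable.of_comap_le (le_sup_of_le_right ?_)
        exact le_iSup₂_of_le (some j) (show some j ∈ G.compExo R' i from hj) le_rfl
      · simp only [hj, if_false]
        exact measurable_const
    have ht : Measurable[m] fun ω => if G.SameSCC a i then T (r ω) else T ω₀ := by
      by_cases hi : G.SameSCC a i
      · simp only [hi, if_true]
        refine Measurable.of_comap_le (le_sup_of_le_right ?_)
        exact le_iSup₂_of_le none
          (show none ∈ G.compExo R' i from ⟨a, hi, show a = a from rfl⟩) le_rfl
      · simp only [hi, if_false]
        exact measurable_const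
    have hcomp : (fun ω => X (r ω) i) = fun ω =>
        Φ i (fun l => if l ∈ G.compPa i then X (r ω) l else X ω₀ l,
          fun j => if j ∈ G.compExo R i then E (r ω) j else E ω₀ j,
          if G.SameSCC a i then T (r ω) else T ω₀) := by
      funext ω
      rw [hreq ω i]
      refine hdep i _ _ _ _ _ _ ?_ ?_ ?_
      · intro p hp
        simp only [hp, if_true]
      · intro j hj
        simp only [hj, if_true]
      · intro hi
        simp only [hi, if_true]
    have : Measurable[m] fun ω => X (r ω) i := by
      rw [hcomp]
      exact (hΦ i).comp (hx.prodMk (he.prodMk ht))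
    exact this.comap_le

end DMG

namespace DMG

lemma mem_ancestors_of_isAncestor {I : Type*} {G : DMG I} {D : Set I} :
    ∀ i ∈ G.ancestors D, ∀ p, G.IsAncestor p i → p ∈ G.ancestors D :=
  fun _ hi _ hp => hp.mem_ancestors hi

end DMG

/-! ### Markov properties of simple models, observational and under randomised intervention. -/

namespace SCM

variable {I J : Type*} {𝒳 : I → Type*} {ℰ : J → Type*}
  [∀ i, MeasurableSpace (𝒳 i)] [∀ j, MeasurableSpace (ℰ j)] [Fintype J] {M : SCM I J 𝒳 ℰ}

instance isProbabilityMeasure_noise (M : SCM I J 𝒳 ℰ) (j : J) :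
    IsProbabilityMeasure (M.noise j) := M.prob_noise j

instance isProbabilityMeasure_exoLaw (M : SCM I J 𝒳 ℰ) : IsProbabilityMeasure M.exoLaw := by
  unfold exoLaw
  infer_instance

/-- A solution function for the variables in `O` that keeps the values of all other variables. -/
structure IsSolver (M : SCM I J 𝒳 ℰ) (O : Set I)
    (s : (∀ i, 𝒳 i) × (∀ j, ℰ j) → ∀ i, 𝒳 i) : Prop where
  measurable : Measurable s
  apply_of_notMem : ∀ z, ∀ i ∉ O, s z i = z.1 i
  congr : ∀ z z' : (∀ i, 𝒳 i) × (∀ j, ℰ j), (∀ l ∈ M.endoPa O \ O, z.1 l = z'.1 l) →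
    (∀ j ∈ M.exoPa O, z.2 j = z'.2 j) → ∀ i ∈ O, s z i = s z' i
  ae_solves : ∀ᵐ e ∂M.exoLaw, ∀ x : ∀ i, 𝒳 i,
    (∀ i ∈ O, s (x, e) i = M.f i (s (x, e), e)) ∧
      ((∀ i ∈ O, x i = M.f i (x, e)) → s (x, e) = x)

open scoped Classical in
-- The solution map is extended by the identity outside `O`. Unique solvability applied to its
-- output shows that it solves the equations; applied to `x`, that it fixes solutions.
lemma UniquelySolvable.exists_isSolver {O : Set I} (h : M.UniquelySolvable O) :
    ∃ s, M.IsSolver O s := by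
  obtain ⟨g, hg, hsol⟩ := h
  set s : (∀ i, 𝒳 i) × (∀ j, ℰ j) → ∀ i, 𝒳 i := fun z i =>
    if h : i ∈ O then g ((M.endoPa O \ O).domRestrict z.1, (M.exoPa O).domRestrict z.2) ⟨i, h⟩
    else z.1 i with hs
  have hs_mem : ∀ z i (hi : i ∈ O), s z i =
      g ((M.endoPa O \ O).domRestrict z.1, (M.exoPa O).domRestrict z.2) ⟨i, hi⟩ :=
    fun z i hi => by simp [hs, hi]
  have hs_notMem : ∀ z, ∀ i ∉ O, s z i = z.1 i := fun z i hi => by simp [hs, hi]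
  refine ⟨s, ?_, hs_notMem, ?_, ?_⟩
  · refine measurable_pi_iff.2 fun i => ?_
    by_cases hi : i ∈ O
    · simp only [hs, hi, dite_true]
      refine (measurable_pi_apply _).comp (hg.comp (Measurable.prodMk ?_ ?_))
      · exact measurable_pi_iff.2 fun l => (measurable_pi_apply _).comp measurable_fst
      · exact measurable_pi_iff.2 fun l => (measurable_pi_apply _).comp measurable_snd
    · simp only [hs, hi, dite_false]
      exact (measurable_pi_apply _).comp measurable_fst
  · intro z z' hx he i hi
    rw [hs_mem z i hi, hs_mem z' i hi]
    have e₁ : (M.endoPa O \ O).domRestrict z.1 = (M.endoPa O \ O).domRestrict z'.1 :=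
      funext fun l => hx l l.2
    have e₂ : (M.exoPa O).domRestrict z.2 = (M.exoPa O).domRestrict z'.2 :=
      funext fun j => he j j.2
    rw [e₁, e₂]
  · filter_upwards [hsol] with e he x
    constructor
    · have hr : (M.endoPa O \ O).domRestrict (s (x, e)) = (M.endoPa O \ O).domRestrict x :=
        funext fun l => hs_notMem (x, e) l l.2.2
      have := (he (s (x, e))).1 fun i => by rw [hr]; exact hs_mem (x, e) i i.2
      exact fun i hi => this ⟨i, hi⟩
    · intro hx
      have := (he x).2 fun i => hx i i.2
      funext i
      by_cases hi : i ∈ O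
      · rw [hs_mem _ i hi]
        exact (this ⟨i, hi⟩).symm
      · exact hs_notMem _ i hi

lemma bi_of_exoParent (j : J) (i k : I) (hi : M.ExoParent j i) (hk : M.ExoParent j k)
    (hik : i ≠ k) : M.graph.bi i k :=
  ⟨hik, j, hi, hk⟩

lemma mem_compPa {i l : I} (hl : l ∈ M.endoPa {k | M.graph.SameSCC k i})
    (hli : ¬ M.graph.SameSCC l i) : l ∈ M.graph.compPa i := by
  obtain ⟨k, hk, hlk⟩ := hl
  refine ⟨hli, k, hk, ?_, hlk⟩
  rintro rfl
  exact hli hk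

variable [Finite I] [∀ i, StandardBorelSpace (𝒳 i)] [∀ j, StandardBorelSpace (ℰ j)]

/-- The global Markov property of simple models for σ-separation. -/
theorem IsSimple.condIndepVars (hM : M.IsSimple) {μ : Measure (∀ i, 𝒳 i)}
    [IsProbabilityMeasure μ] (hμ : M.IsSolutionLaw μ) {a b : I} {C : Set I} (ha : a ∉ C)
    (hb : b ∉ C) (hsep : M.graph.SigmaSep a b C) : CondIndepVars μ a b C := by
  obtain ⟨ρ, hρ1, hρ2, hρ⟩ := hμ
  have hρp : IsProbabilityMeasure ρ := by
    constructor
    have := measure_univ (μ := μ)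
    rwa [← hρ1, Measure.fst_univ] at this
  choose s hs using fun O => (hM O).exists_isSolver
  have hae : ∀ O, ∀ᵐ z ∂ρ, ∀ x : ∀ i, 𝒳 i, (∀ i ∈ O, s O (x, z.2) i = M.f i (s O (x, z.2), z.2)) ∧
      ((∀ i ∈ O, x i = M.f i (x, z.2)) → s O (x, z.2) = x) := by
    intro O
    have := (hs O).ae_solves
    rw [← hρ2] at this
    exact ae_of_ae_map measurable_snd.aemeasurable this
  have hCm : Measurable fun z : (∀ i, 𝒳 i) × (∀ j, ℰ j) => C.domRestrict z.1 :=
    measurable_pi_iff.2 fun l => (measurable_pi_apply _).comp measurable_fst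
  -- The extra variable `T` is trivial here, and each variable is computed by solving its component.
  have key := DMG.condIndepFun_of_equations (G := M.graph) (R := M.ExoParent) bi_of_exoParent
    (P := ρ) (X := Prod.fst) (E := Prod.snd) (T := fun _ => ()) measurable_fst measurable_snd
    measurable_const (noise := M.noise) (τ := Measure.dirac ()) ?_ (a := a) (b := b)
    (A := M.graph.ancestors (C ∪ {a} ∪ {b})) (C := C)
    (fun i z => s {k | M.graph.SameSCC k i} (z.1, z.2.1) i) ?_ ?_ ?_
    DMG.mem_ancestors_of_isAncestor
    (fun c hc => DMG.subset_ancestors _ (.inl (.inl hc))) (DMG.subset_ancestors _ (.inl (.inr rfl)))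
    (DMG.subset_ancestors _ (.inr rfl)) (hsep.not_moralChain ha hb) hCm
  · obtain ⟨x₀⟩ : Nonempty (∀ i, 𝒳 i) := nonempty_of_isProbabilityMeasure μ
    have : ∀ i, Nonempty (𝒳 i) := fun i => ⟨x₀ i⟩
    have key' : CondIndepFun (MeasurableSpace.comap
        (fun z : (∀ i, 𝒳 i) × (∀ j, ℰ j) => C.domRestrict z.1) inferInstance) hCm.comap_le
        (fun z => z.1 a) (fun z => z.1 b) ρ := key.comp measurable_fst measurable_id
    refine key'.of_map_eq ((measurable_pi_apply a).comp measurable_fst)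
      ((measurable_pi_apply b).comp measurable_fst) hCm (measurable_pi_apply a)
      (measurable_pi_apply b) (Set.measurable_restrict C) ?_
    have hm : Measurable fun x : ∀ i, 𝒳 i => (C.domRestrict x, x a, x b) :=
      Measurable.prodMk (Set.measurable_restrict C)
        ((measurable_pi_apply a).prodMk (measurable_pi_apply b))
    rw [← hρ1, Measure.fst, Measure.map_map hm measurable_fst]
    rfl
  · rw [Measure.dirac_prod]
    change _ = Measure.map _ M.exoLaw
    rw [← hρ2, Measure.snd, Measure.map_map (by fun_prop) (by fun_prop)]
    rfl
  · exact fun i => (measurable_pi_apply i).comp ((hs _).measurable.comp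
      (measurable_fst.prodMk measurable_snd.fst))
  · intro i x x' e e' t t' hx he _
    exact (hs _).congr _ _ (fun l hl => hx l (mem_compPa hl.1 hl.2)) (fun j hj => he j hj) i
      (DMG.SameSCC.refl i)
  · filter_upwards [hρ, ae_all_iff.2 fun i => hae {k | M.graph.SameSCC k i}] with z hz hsz i
    rw [((hsz i) z.1).2 fun k _ => hz k]

/-- The Markov property for a mixture, controlled by the exogenous variable `T`, of a simple
model and its interventions on `X`. -/
theorem IsSimple.condIndepFun_intervention [DecidableEq I] (hM : M.IsSimple) {X Y : I} {C : Set I}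
    (hX : X ∈ C) {τ : Measure (Bool × 𝒳 X)} [IsProbabilityMeasure τ]
    {x : (Bool × 𝒳 X) × (∀ j, ℰ j) → ∀ i, 𝒳 i} (hx : Measurable x)
    (heq : ∀ᵐ ω ∂τ.prod M.exoLaw, (ω.1.1 = true → x ω X = ω.1.2) ∧
      ∀ i, (i = X → ω.1.1 = false) → x ω i = M.f i (x ω, ω.2))
    (hXY : ¬ Relation.ReflTransGen (M.graph.MoralStep (M.graph.ancestors (C ∪ {Y})) C) X Y)
    (hCm : Measurable fun ω => C.domRestrict (x ω)) :
    CondIndepFun (MeasurableSpace.comap (fun ω => C.domRestrict (x ω)) inferInstance)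
      hCm.comap_le (fun ω => ω.1) (fun ω => x ω Y) (τ.prod M.exoLaw) := by
  classical
  choose s hs using fun O => (hM O).exists_isSolver
  have hae : ∀ O, ∀ᵐ ω ∂τ.prod M.exoLaw, ∀ x : ∀ i, 𝒳 i,
      (∀ i ∈ O, s O (x, ω.2) i = M.f i (s O (x, ω.2), ω.2)) ∧
      ((∀ i ∈ O, x i = M.f i (x, ω.2)) → s O (x, ω.2) = x) := fun O =>
    (Measure.quasiMeasurePreserving_snd (μ := τ) (ν := M.exoLaw)).ae (hs O).ae_solves
  set K : I → Set I := fun i => {k | M.graph.SameSCC k i} with hK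
  -- Components are those of the original graph. When the intervention is active, the component of
  -- `X` is solved without `X`, with the prescribed value inserted; this uses solvability of a set
  -- that need not be a component.
  have key := DMG.condIndepFun_of_equations (G := M.graph) (R := M.ExoParent) bi_of_exoParent
    (P := τ.prod M.exoLaw) (X := x) (E := Prod.snd) (T := Prod.fst) hx measurable_snd
    measurable_fst (noise := M.noise) (τ := τ) (by exact Measure.map_id) (a := X) (b := Y)
    (A := M.graph.ancestors (C ∪ {Y})) (C := C)
    (fun i z => if z.2.2.1 = true ∧ M.graph.SameSCC X i then
      s (K i \ {X}) (Function.update z.1 X z.2.2.2, z.2.1) i else s (K i) (z.1, z.2.1) i) ?_ ?_ ?_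
    DMG.mem_ancestors_of_isAncestor
    (fun c hc => DMG.subset_ancestors _ (.inl hc)) (DMG.subset_ancestors _ (.inl hX))
    (DMG.subset_ancestors _ (.inr rfl)) hXY hCm
  · exact key.comp measurable_snd measurable_id
  · intro i
    have hm : Measurable fun z : (∀ i, 𝒳 i) × (∀ j, ℰ j) × (Bool × 𝒳 X) =>
        Function.update z.1 X z.2.2.2 := by
      refine measurable_pi_iff.2 fun l => ?_
      by_cases hl : l = X
      · subst hl
        simpa using (by fun_prop : Measurable fun z :
          (∀ i, 𝒳 i) × (∀ j, ℰ j) × (Bool × 𝒳 l) => z.2.2.2)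
      · simp only [Function.update_of_ne hl]
        fun_prop
    refine Measurable.ite ?_ ((measurable_pi_apply i).comp ((hs _).measurable.comp ?_))
      ((measurable_pi_apply i).comp ((hs _).measurable.comp ?_))
    · by_cases hi : M.graph.SameSCC X i
      · simp only [hi, and_true]
        exact (by fun_prop : Measurable fun z : (∀ i, 𝒳 i) × (∀ j, ℰ j) × (Bool × 𝒳 X) =>
          z.2.2.1) (measurableSet_singleton true)
      · simp [hi]
    · exact hm.prodMk (by fun_prop)
    · fun_prop
  · intro i y y' e e' t t' hy he ht
    by_cases hi : M.graph.SameSCC X i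
    · obtain rfl := ht hi
      by_cases hb : t.1 = true
      · simp only [hb, hi, and_self, if_true]
        by_cases hiX : i = X
        · subst hiX
          rw [(hs _).apply_of_notMem _ _ (by simp), (hs _).apply_of_notMem _ _ (by simp)]
          simp
        · refine (hs _).congr _ _ (fun l hl => ?_) (fun j hj => he j ?_) i
            ⟨DMG.SameSCC.refl i, hiX⟩
          · by_cases hlX : l = X
            · subst hlX
              simp
            · simp only [Function.update_of_ne hlX]
              obtain ⟨⟨k, hk, hlk⟩, hl⟩ := hl
              exact hy l (mem_compPa ⟨k, hk.1, hlk⟩ fun h => hl ⟨h, hlX⟩)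
          · obtain ⟨k, hk, hjk⟩ := hj
            exact ⟨k, hk.1, hjk⟩
      · simp only [hb]
        exact (hs _).congr _ _ (fun l hl => hy l (mem_compPa hl.1 hl.2)) (fun j hj => he j hj) i
          (DMG.SameSCC.refl i)
    · simp only [hi, and_false]
      exact (hs _).congr _ _ (fun l hl => hy l (mem_compPa hl.1 hl.2)) (fun j hj => he j hj) i
        (DMG.SameSCC.refl i)
  · filter_upwards [heq, ae_all_iff.2 fun i => hae (K i),
      ae_all_iff.2 fun i => hae (K i \ {X})] with ω hω hs1 hs2 i
    split_ifs with h
    · have hu : Function.update (x ω) X ω.1.2 = x ω := by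
        rw [← hω.1 h.1, Function.update_eq_self]
      rw [hu, (hs2 i (x ω)).2 fun k hk => hω.2 k fun e => absurd e hk.2]
    · rw [(hs1 i (x ω)).2 fun k hk => hω.2 k ?_]
      rintro rfl
      simpa using fun hb => h ⟨hb, hk⟩

end SCM

/-! ### Conditional distributions on slices. -/

namespace ProbabilityTheory

section HasCondDistrib

variable {Ω Ω' α β γ : Type*} {mΩ : MeasurableSpace Ω} {mΩ' : MeasurableSpace Ω'}
  {mα : MeasurableSpace α} {mβ : MeasurableSpace β} {mγ : MeasurableSpace γ}
  {P : Measure Ω} {P' : Measure Ω'}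

lemma HasCondDistrib.of_map_eq {k : Ω → α} {Y : Ω → β} {k' : Ω' → α} {Y' : Ω' → β}
    {κ : Kernel α β} (h : HasCondDistrib Y k κ P) (hk' : Measurable k') (hY' : Measurable Y')
    (e : P.map (fun ω => (k ω, Y ω)) = P'.map fun ω => (k' ω, Y' ω)) :
    HasCondDistrib Y' k' κ P' := by
  refine ⟨(hk'.prodMk hY').aemeasurable, ?_⟩
  have ek : P.map k = P'.map k' := by
    have := congrArg (Measure.map Prod.fst) e
    rwa [AEMeasurable.map_map_of_aemeasurable measurable_fst.aemeasurable h.aemeasurable,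
      Measure.map_map measurable_fst (hk'.prodMk hY')] at this
  rw [← e, ← ek]
  exact h.map_eq

lemma HasCondDistrib.of_smul {k : Ω → α} {Y : Ω → β} {κ : Kernel α β} [IsMarkovKernel κ]
    [IsFiniteMeasure P] {c : ENNReal} (hc : c ≠ 0) (hc' : c ≠ ⊤) (hk : Measurable k)
    (hY : Measurable Y) (h : HasCondDistrib Y k κ (c • P)) : HasCondDistrib Y k κ P := by
  refine ⟨(hk.prodMk hY).aemeasurable, ?_⟩
  have := congrArg (c⁻¹ • ·) h.map_eq
  simpa only [Measure.map_smul, Measure.compProd_smul_left, smul_smul,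
    ENNReal.inv_mul_cancel hc hc', one_smul] using this

/-- The kernel ignores `T`, so testing the disintegration on events that include `T ∈ D` gives it
for the restricted measure. -/
lemma HasCondDistrib.restrict_preimage {k : Ω → α} {Y : Ω → β} {T : Ω → γ} {κ : Kernel α β}
    [IsMarkovKernel κ] [IsFiniteMeasure P] (hk : Measurable k) (hY : Measurable Y)
    (hT : Measurable T)
    (h : HasCondDistrib Y (fun ω => (k ω, T ω)) (κ.prodMkRight γ) P) {D : Set γ}
    (hD : MeasurableSet D) : HasCondDistrib Y k κ (P.restrict (T ⁻¹' D)) := by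
  refine ⟨(hk.prodMk hY).aemeasurable, ?_⟩
  ext U hU
  set U' : Set ((α × γ) × β) := {z | z.1.2 ∈ D ∧ (z.1.1, z.2) ∈ U} with hU'
  have hU'm : MeasurableSet U' :=
    (measurable_fst.snd hD).inter ((measurable_fst.fst.prodMk measurable_snd) hU)
  have h1 := congrArg (· U') h.map_eq
  simp only at h1
  rw [Measure.map_apply (by fun_prop) hU'm, Measure.compProd_apply hU'm,
    lintegral_map (Kernel.measurable_kernel_prodMk_left hU'm) (by fun_prop)] at h1
  rw [Measure.map_apply (by fun_prop) hU, Measure.restrict_apply ((hk.prodMk hY) hU),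
    Measure.compProd_apply hU, lintegral_map (Kernel.measurable_kernel_prodMk_left hU) hk,
    ← lintegral_indicator (hT hD)]
  convert h1 using 1
  · congr 1
    ext ω
    simp [hU', and_comm]
  · refine lintegral_congr fun ω => ?_
    by_cases hω : T ω ∈ D
    · rw [Set.indicator_of_mem (show ω ∈ T ⁻¹' D from hω)]
      simp [hU', hω, Set.preimage]
    · rw [Set.indicator_of_notMem (show ω ∉ T ⁻¹' D from hω)]
      simp [hU', hω, Set.preimage]

/-- Slicing a conditional distribution that does not depend on an independent coin. -/
lemma HasCondDistrib.slice {A B : Type*} [MeasurableSpace A] [MeasurableSpace B]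
    {coin : Measure Bool} [IsFiniteMeasure coin] {l : Measure A} [IsFiniteMeasure l]
    {Q : Measure B} [IsFiniteMeasure Q] {k : (Bool × A) × B → α} {Y : (Bool × A) × B → β}
    {κ : Kernel α β} [IsMarkovKernel κ] (hk : Measurable k) (hY : Measurable Y)
    (h : HasCondDistrib Y (fun ω => (k ω, ω.1)) (κ.prodMkRight _) ((coin.prod l).prod Q))
    {b : Bool} (hb : coin {b} ≠ 0) :
    HasCondDistrib (fun z : A × B => Y ((b, z.1), z.2)) (fun z : A × B => k ((b, z.1), z.2)) κ
      (l.prod Q) := by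
  have hD : MeasurableSet ({b} ×ˢ Set.univ : Set (Bool × A)) :=
    (measurableSet_singleton b).prod .univ
  have h1 := h.restrict_preimage hk hY measurable_fst hD
  have hj : Measurable fun z : A × B => ((b, z.1), z.2) := by fun_prop
  -- Restricting to one face of the coin yields a copy of `l.prod Q` up to the factor `coin {b}`,
  -- which cancels in a disintegration.
  have e : ((coin.prod l).prod Q).restrict (Prod.fst ⁻¹' ({b} ×ˢ Set.univ)) =
      coin {b} • (l.prod Q).map fun z => ((b, z.1), z.2) := by
    rw [← Set.prod_univ, ← Measure.prod_restrict, ← Measure.prod_restrict,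
      Measure.restrict_singleton, Measure.restrict_univ, Measure.restrict_univ,
      Measure.prod_smul_left, Measure.prod_smul_left, Measure.dirac_prod]
    congr 1
    conv_lhs => rw [← Measure.map_id (μ := Q)]
    rw [Measure.map_prod_map _ _ measurable_prodMk_left measurable_id]
    rfl
  rw [e] at h1
  have h2 := h1.of_smul hb (measure_ne_top _ _) hk hY
  refine h2.of_map_eq (hk.comp hj) (hY.comp hj) ?_
  rw [Measure.map_map (hk.prodMk hY) hj]
  rfl

end HasCondDistrib

end ProbabilityTheory

/-! ### Laws of solutions and the intervention kernel. -/

namespace SCM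

variable {I J : Type*} {𝒳 : I → Type*} {ℰ : J → Type*}
  [∀ i, MeasurableSpace (𝒳 i)] [∀ j, MeasurableSpace (ℰ j)] [Fintype J] {M : SCM I J 𝒳 ℰ}

/-- No endogenous variable lies outside `Set.univ`, so the solver depends on the noise alone and
`x₀` is an arbitrary filler. -/
lemma IsSolver.law_eq {s : (∀ i, 𝒳 i) × (∀ j, ℰ j) → ∀ i, 𝒳 i} (hs : M.IsSolver Set.univ s)
    {μ : Measure (∀ i, 𝒳 i)} (hμ : M.IsSolutionLaw μ) (x₀ : ∀ i, 𝒳 i) :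
    μ = M.exoLaw.map fun e => s (x₀, e) := by
  obtain ⟨ρ, rfl, hρ2, hρ⟩ := hμ
  have hm : Measurable fun e => s (x₀, e) := hs.measurable.comp measurable_prodMk_left
  have := hs.ae_solves
  rw [← hρ2] at this ⊢
  have := ae_of_ae_map measurable_snd.aemeasurable this
  rw [Measure.fst, Measure.snd, Measure.map_map hm measurable_snd]
  refine Measure.map_congr ?_
  filter_upwards [this, hρ] with z h1 h2
  rw [← (h1 z.1).2 fun i _ => h2 i]
  funext i
  exact hs.congr (z.1, z.2) (x₀, z.2) (fun l hl => absurd trivial hl.2) (fun _ _ => rfl) i trivial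

/-- The intervention keeps all equations other than that of `X`, and the solver for these sees the
filler only at `X`, where it is ξ. -/
lemma IsSolver.intervene_law_eq [DecidableEq I] {X : I}
    {s : (∀ i, 𝒳 i) × (∀ j, ℰ j) → ∀ i, 𝒳 i} (hs : M.IsSolver {X}ᶜ s) {ξ : 𝒳 X}
    {ν : Measure (∀ i, 𝒳 i)} (hν : (M.intervene X ξ).IsSolutionLaw ν) (x₀ : ∀ i, 𝒳 i) :
    ν = M.exoLaw.map fun e => s (Function.update x₀ X ξ, e) := by
  obtain ⟨ρ, rfl, hρ2, hρ⟩ := hν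
  have hρ2 : ρ.snd = M.exoLaw := hρ2
  have hm : Measurable fun e => s (Function.update x₀ X ξ, e) :=
    hs.measurable.comp measurable_prodMk_left
  have := hs.ae_solves
  rw [← hρ2] at this ⊢
  have := ae_of_ae_map measurable_snd.aemeasurable this
  rw [Measure.fst, Measure.snd, Measure.map_map hm measurable_snd]
  refine Measure.map_congr ?_
  filter_upwards [this, hρ] with z h1 h2
  have hX : z.1 X = ξ := by simpa [intervene] using h2 X
  have hi : ∀ i ∈ ({X}ᶜ : Set I), z.1 i = M.f i z := by
    intro i hi
    have := h2 i
    simpa only [intervene, Function.update_of_ne (show i ≠ X from hi)] using this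
  have he := (h1 z.1).2 hi
  funext i
  by_cases hiX : i = X
  · subst hiX
    simp only [Function.comp]
    rw [hs.apply_of_notMem _ _ (by simp)]
    simpa using hX
  · conv_lhs => rw [← he]
    refine hs.congr (z.1, z.2) (Function.update x₀ X ξ, z.2) (fun l hl => ?_) (fun _ _ => rfl) i hiX
    have hl : l = X := by simpa using hl.2
    subst hl
    simpa using hX

end SCM

namespace SCM

variable {I J : Type*} {𝒳 : I → Type*} {ℰ : J → Type*}
  [∀ i, MeasurableSpace (𝒳 i)] [∀ j, MeasurableSpace (ℰ j)] [Fintype J] {M : SCM I J 𝒳 ℰ}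
  [Finite I] [∀ i, StandardBorelSpace (𝒳 i)] [∀ j, StandardBorelSpace (ℰ j)]

/-- If no chain leads from `X` to `Y`, then there is a kernel that is at the same time the
conditional distribution of `Y` given `X` and `S` and, for each value `ξ` of `X`, the conditional
distribution of `Y` given `S` under the intervention that sets `X` to `ξ`. -/
theorem IsSimple.exists_intervention_kernel [DecidableEq I] (hM : M.IsSimple)
    {μ : Measure (∀ i, 𝒳 i)} [IsProbabilityMeasure μ] (hμ : M.IsSolutionLaw μ) {X Y : I}
    {S : Set I}
    (hXY : ¬ Relation.ReflTransGen
      (M.graph.MoralStep (M.graph.ancestors (S ∪ {X} ∪ {Y})) (S ∪ {X})) X Y) :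
    ∃ κ : Kernel (𝒳 X × (∀ s : ↥S, 𝒳 s)) (𝒳 Y), IsMarkovKernel κ ∧
      HasCondDistrib (fun x : ∀ i, 𝒳 i => x Y)
        (fun x : ∀ i, 𝒳 i => (x X, S.domRestrict x)) κ μ ∧
      ∀ (ξ : 𝒳 X) (ν : Measure (∀ i, 𝒳 i)), (M.intervene X ξ).IsSolutionLaw ν →
        HasCondDistrib (fun x : ∀ i, 𝒳 i => x Y) (fun x : ∀ i, 𝒳 i => S.domRestrict x)
          (κ.sectR ξ) ν := by
  classical
  obtain ⟨x₀⟩ : Nonempty (∀ i, 𝒳 i) := nonempty_of_isProbabilityMeasure μ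
  have hne : ∀ i, Nonempty (𝒳 i) := fun i => ⟨x₀ i⟩
  obtain ⟨s₀, hs₀⟩ := (hM Set.univ).exists_isSolver
  obtain ⟨s₁, hs₁⟩ := (hM {X}ᶜ).exists_isSolver
  have hS : Measurable (S.domRestrict : (∀ i, 𝒳 i) → ∀ i : ↥S, 𝒳 i) := Set.measurable_restrict S
  set coin : Measure Bool := (2⁻¹ : ENNReal) • (Measure.dirac true + Measure.dirac false) with hcoin
  have hcoinp : IsProbabilityMeasure coin := by
    constructor
    simp only [hcoin, Measure.smul_apply, Measure.add_apply, measure_univ, smul_eq_mul]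
    rw [one_add_one_eq_two, ENNReal.inv_mul_cancel (by simp) (by simp)]
  have hcoinb : ∀ b, coin {b} ≠ 0 := by
    intro b
    cases b <;> simp [hcoin]
  -- The random target value has the observational law of `X`, so that exceptional null sets of
  -- targets are also null under `μ`.
  set l : Measure (𝒳 X) := μ.map fun x => x X with hl
  have hlp : IsProbabilityMeasure l :=
    Measure.isProbabilityMeasure_map (measurable_pi_apply X).aemeasurable
  have h₀m : Measurable fun e => s₀ (x₀, e) := hs₀.measurable.comp measurable_prodMk_left
  have h₁m : Measurable fun z : 𝒳 X × (∀ j, ℰ j) => s₁ (Function.update x₀ X z.1, z.2) :=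
    hs₁.measurable.comp (((measurable_update x₀).comp measurable_fst).prodMk measurable_snd)
  have h₁X : ∀ ξ e, s₁ (Function.update x₀ X ξ, e) X = ξ := fun ξ e => by
    rw [hs₁.apply_of_notMem _ _ (by simp)]
    simp
  set x : (Bool × 𝒳 X) × (∀ j, ℰ j) → ∀ i, 𝒳 i := fun ω =>
    if ω.1.1 = true then s₁ (Function.update x₀ X ω.1.2, ω.2) else s₀ (x₀, ω.2) with hxdef
  have hx : Measurable x := by
    refine Measurable.ite (measurable_fst.fst (measurableSet_singleton true)) ?_ ?_
    · exact h₁m.comp (measurable_fst.snd.prodMk measurable_snd)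
    · exact h₀m.comp measurable_snd
  have heq : ∀ᵐ ω ∂(coin.prod l).prod M.exoLaw, (ω.1.1 = true → x ω X = ω.1.2) ∧
      ∀ i, (i = X → ω.1.1 = false) → x ω i = M.f i (x ω, ω.2) := by
    have hq := Measure.quasiMeasurePreserving_snd (μ := coin.prod l) (ν := M.exoLaw)
    filter_upwards [hq.ae hs₀.ae_solves, hq.ae hs₁.ae_solves] with ω h0 h1
    by_cases hb : ω.1.1 = true
    · simp only [hxdef, hb, if_true]
      refine ⟨fun _ => h₁X _ _, fun i hi => (h1 _).1 i fun h => ?_⟩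
      exact absurd (hi h) (by simp)
    · simp only [hxdef, hb]
      exact ⟨fun h => absurd h (by simp), fun i _ => (h0 _).1 i trivial⟩
  have hCm : Measurable fun ω => (S ∪ {X}).domRestrict (x ω) := (Set.measurable_restrict _).comp hx
  have hCI := hM.condIndepFun_intervention (X := X) (Y := Y) (C := S ∪ {X}) (.inr rfl)
    (τ := coin.prod l) hx heq hXY hCm
  set k : (Bool × 𝒳 X) × (∀ j, ℰ j) → 𝒳 X × (∀ s : ↥S, 𝒳 s) :=
    fun ω => (x ω X, S.domRestrict (x ω)) with hk
  have hxi : ∀ i, Measurable fun ω => x ω i := fun i => (measurable_pi_apply i).comp hx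
  have hkm : Measurable k := (hxi X).prodMk (hS.comp hx)
  have hcomap : MeasurableSpace.comap (fun ω => (S ∪ {X}).domRestrict (x ω)) inferInstance =
      MeasurableSpace.comap k inferInstance := by
    have e₁ : MeasurableSpace.comap (fun ω => (S ∪ {X}).domRestrict (x ω)) inferInstance =
        ⨆ c : ↥(S ∪ {X}), MeasurableSpace.comap (fun ω => x ω c) inferInstance :=
      MeasurableSpace.comap_process_pi fun (c : ↥(S ∪ {X})) ω => x ω c
    have e₂ : MeasurableSpace.comap k inferInstance =
        MeasurableSpace.comap (fun ω => x ω X) inferInstance ⊔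
          ⨆ c : ↥S, MeasurableSpace.comap (fun ω => x ω c) inferInstance :=
      (MeasurableSpace.comap_prodMk (fun ω => x ω X) fun ω => S.domRestrict (x ω)).trans
        (congrArg _ (MeasurableSpace.comap_process_pi fun (c : ↥S) ω => x ω c))
    rw [e₁, e₂]
    apply le_antisymm
    · refine iSup_le fun c => ?_
      obtain ⟨c, hc | rfl⟩ := c
      · exact le_sup_of_le_right (le_iSup_of_le ⟨c, hc⟩ le_rfl)
      · exact le_sup_left
    · refine sup_le (le_iSup_of_le ⟨X, .inr rfl⟩ le_rfl) (iSup_le fun c => ?_)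
      exact le_iSup_of_le ⟨c, .inl c.2⟩ le_rfl
  have hCI' : CondIndepFun (MeasurableSpace.comap k inferInstance) hkm.comap_le
      (fun ω => ω.1) (fun ω => x ω Y) ((coin.prod l).prod M.exoLaw) := by
    rw [condIndepFun_iff_condIndep] at hCI ⊢
    exact hCI.congr_cond hcomap
  rw [condIndepFun_iff_condDistrib_prod_ae_eq_prodMkRight (hxi Y) measurable_fst hkm] at hCI'
  set κ' := condDistrib (fun ω => x ω Y) k ((coin.prod l).prod M.exoLaw) with hκ'
  have hcd : HasCondDistrib (fun ω => x ω Y) (fun ω => (k ω, ω.1))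
      (κ'.prodMkRight (Bool × 𝒳 X)) ((coin.prod l).prod M.exoLaw) := by
    refine ⟨((hkm.prodMk measurable_fst).prodMk (hxi Y)).aemeasurable, ?_⟩
    rw [← Measure.compProd_congr hCI', compProd_map_condDistrib (hxi Y).aemeasurable]
  have hobs : HasCondDistrib (fun x : ∀ i, 𝒳 i => x Y)
      (fun x : ∀ i, 𝒳 i => (x X, S.domRestrict x)) κ' μ := by
    refine (hcd.slice hkm (hxi Y) (hcoinb false)).of_map_eq
      ((measurable_pi_apply X).prodMk hS) (measurable_pi_apply Y) ?_
    have hm : Measurable fun x : ∀ i, 𝒳 i => ((x X, S.domRestrict x), x Y) :=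
      ((measurable_pi_apply X).prodMk hS).prodMk (measurable_pi_apply Y)
    conv_rhs => rw [hs₀.law_eq hμ x₀, Measure.map_map hm h₀m]
    conv_rhs => rw [← Measure.snd_prod (μ := l) (ν := M.exoLaw), Measure.snd,
      Measure.map_map (hm.comp h₀m) measurable_snd]
    rfl
  have hint : HasCondDistrib (fun z : 𝒳 X × (∀ j, ℰ j) => s₁ (Function.update x₀ X z.1, z.2) Y)
      (fun z => (z.1, S.domRestrict (s₁ (Function.update x₀ X z.1, z.2)))) κ'
      (l.prod M.exoLaw) := by
    have := hcd.slice hkm (hxi Y) (hcoinb true)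
    simpa only [hk, hxdef, if_true, h₁X] using this
  have hFm : Measurable fun x : ∀ i, 𝒳 i => (S.domRestrict x, x Y) :=
    hS.prodMk (measurable_pi_apply Y)
  set F : 𝒳 X × (∀ j, ℰ j) → (∀ s : ↥S, 𝒳 s) × 𝒳 Y := fun z =>
    (S.domRestrict (s₁ (Function.update x₀ X z.1, z.2)), s₁ (Function.update x₀ X z.1, z.2) Y)
    with hF
  have hFm' : Measurable F := hFm.comp h₁m
  have hFξ : ∀ ξ, Measurable fun e => F (ξ, e) := fun ξ => hFm'.comp measurable_prodMk_left
  have hsξ : ∀ ξ, Measurable fun e => s₁ (Function.update x₀ X ξ, e) := fun ξ =>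
    hs₁.measurable.comp measurable_prodMk_left
  -- `η ξ` is the joint law of the selection variables and `Y` under `do(X = ξ)`.
  set η : Kernel (𝒳 X) ((∀ s : ↥S, 𝒳 s) × 𝒳 Y) :=
    (Kernel.id ×ₖ Kernel.const (𝒳 X) M.exoLaw).map F with hη
  have hηp : IsMarkovKernel η := Kernel.IsMarkovKernel.map _ hFm'
  have hη_apply : ∀ ξ, η ξ = M.exoLaw.map fun e => F (ξ, e) := by
    intro ξ
    rw [hη, Kernel.map_apply _ hFm', Kernel.prod_apply, Kernel.id_apply,
      Kernel.const_apply, Measure.dirac_prod, Measure.map_map hFm' measurable_prodMk_left]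
    rfl
  have hlη : l ⊗ₘ η = (l.prod M.exoLaw).map fun z => (z.1, F z) := by
    have hm : Measurable fun z => (z.1, F z) := measurable_fst.prodMk hFm'
    ext U hU
    rw [Measure.compProd_apply hU, Measure.map_apply hm hU, Measure.prod_apply (hm hU)]
    refine lintegral_congr fun ξ => ?_
    rw [hη_apply, Measure.map_apply (hFξ ξ) (measurable_prodMk_left hU)]
    rfl
  -- The coin slice `hint` is an identity of measures integrated over ξ; uniqueness of
  -- disintegrations localises it to almost every ξ.
  have hae : ∀ᵐ ξ ∂l, η ξ = (η.fst ξ) ⊗ₘ κ'.sectR ξ := by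
    have h1 : l ⊗ₘ η = l ⊗ₘ (η.fst ⊗ₖ κ') := by
      have hk₁ : Measurable fun z : 𝒳 X × (∀ j, ℰ j) => (z.1, (F z).1) :=
        measurable_fst.prodMk hFm'.fst
      have hfst : l ⊗ₘ η.fst = (l.prod M.exoLaw).map fun z => (z.1, (F z).1) := by
        rw [Kernel.fst_eq, Measure.compProd_map measurable_fst, hlη,
          Measure.map_map (by fun_prop) (measurable_fst.prodMk hFm')]
        rfl
      rw [← Measure.compProd_assoc', hfst, ← hint.map_eq,
        Measure.map_map (by fun_prop) (hk₁.prodMk hFm'.snd), hlη]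
      rfl
    filter_upwards [Kernel.ae_eq_of_compProd_eq h1] with ξ hξ
    rw [hξ, Kernel.compProd_apply_eq_compProd_sectR]
  set N := toMeasurable l {ξ | ¬ η ξ = (η.fst ξ) ⊗ₘ κ'.sectR ξ} with hN
  have hNm : MeasurableSet N := measurableSet_toMeasurable _ _
  have hN0 : l N = 0 := by rw [hN, measure_toMeasurable]; exact hae
  have hNgood : ∀ ξ ∉ N, η ξ = (η.fst ξ) ⊗ₘ κ'.sectR ξ := fun ξ hξ => by
    by_contra h
    exact hξ (subset_toMeasurable l _ h)
  -- On the null set `N` the interventional conditional kernel is used, so that the claim holds for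
  -- every ξ.
  set κ := Kernel.piecewise (measurable_fst hNm : MeasurableSet
    (Prod.fst ⁻¹' N : Set (𝒳 X × (∀ s : ↥S, 𝒳 s)))) η.condKernel κ' with hκ
  refine ⟨κ, inferInstance, ?_, fun ξ ν hν => ?_⟩
  · refine ⟨hobs.aemeasurable, ?_⟩
    rw [hobs.map_eq]
    refine Measure.compProd_congr ?_
    have hz : ∀ᵐ x ∂μ, x X ∉ N := by
      rw [hl, Measure.map_apply (measurable_pi_apply X) hNm] at hN0
      exact measure_eq_zero_iff_ae_notMem.1 hN0
    have hNae : ∀ᵐ z ∂μ.map (fun x : ∀ i, 𝒳 i => (x X, S.domRestrict x)), z.1 ∉ N :=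
      (ae_map_iff ((measurable_pi_apply X).prodMk hS).aemeasurable
        (measurable_fst hNm.compl)).2 hz
    filter_upwards [hNae] with z hz
    rw [hκ, Kernel.piecewise_apply, if_neg (show z ∉ Prod.fst ⁻¹' N from hz)]
  · have hνη : ν.map (fun x => (S.domRestrict x, x Y)) = η ξ := by
      rw [hη_apply, hs₁.intervene_law_eq hν x₀,
        Measure.map_map hFm (hsξ ξ)]
      rfl
    have hνS : ν.map (fun x => S.domRestrict x) = η.fst ξ := by
      rw [Kernel.fst_apply, ← hνη, Measure.map_map measurable_fst hFm]
      rfl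
    refine ⟨hFm.aemeasurable, ?_⟩
    rw [hνη, hνS]
    by_cases hξ : ξ ∈ N
    · have hsec : κ.sectR ξ = η.condKernel.sectR ξ := by
        ext1 z
        rw [Kernel.sectR_apply, Kernel.sectR_apply, hκ, Kernel.piecewise_apply,
          if_pos (show (ξ, z) ∈ Prod.fst ⁻¹' N from hξ)]
      rw [hsec, ← Kernel.compProd_apply_eq_compProd_sectR, Kernel.disintegrate]
    · have hsec : κ.sectR ξ = κ'.sectR ξ := by
        ext1 z
        rw [Kernel.sectR_apply, Kernel.sectR_apply, hκ, Kernel.piecewise_apply,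
          if_neg (show (ξ, z) ∉ Prod.fst ⁻¹' N from hξ)]
      rw [hsec]
      exact hNgood ξ hξ

end SCM

theorem corollary6
    {I J : Type*} [Fintype I] [DecidableEq I] [Fintype J]
    {𝒳 : I → Type*} {ℰ : J → Type*}
    [∀ i, MeasurableSpace (𝒳 i)] [∀ i, StandardBorelSpace (𝒳 i)]
    [∀ j, MeasurableSpace (ℰ j)] [∀ j, StandardBorelSpace (ℰ j)]
    (M : SCM I J 𝒳 ℰ) (hM : M.IsSimple)
    (μ : Measure (∀ i, 𝒳 i)) [IsProbabilityMeasure μ] (hμ : M.IsSolutionLaw μ)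
    (hfaith : SigmaFaithful M.graph μ)
    (V W X Y : I) (S : Set I)
    (hVW : V ≠ W) (hVX : V ≠ X) (hVY : V ≠ Y) (hWX : W ≠ X) (hWY : W ≠ Y) (hXY : X ≠ Y)
    (hVS : V ∉ S) (hWS : W ∉ S) (hXS : X ∉ S) (hYS : Y ∉ S)
    (hindep : MinCondIndep μ V Y S {X})
    (hdep : MinCondDep μ V W S {X}) :
    M.graph.IsAncestor X Y ∧
    ∃ κ : Kernel (𝒳 X × (∀ s : ↥S, 𝒳 s)) (𝒳 Y), IsMarkovKernel κ ∧
      HasCondDistrib (fun x : ∀ i, 𝒳 i => x Y)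
        (fun x : ∀ i, 𝒳 i => (x X, S.domRestrict x)) κ μ ∧
      ∀ (ξ : 𝒳 X) (ν : Measure (∀ i, 𝒳 i)), (M.intervene X ξ).IsSolutionLaw ν →
        HasCondDistrib (fun x : ∀ i, 𝒳 i => x Y) (fun x : ∀ i, 𝒳 i => S.domRestrict x)
          (κ.sectR ξ) ν := by
  -- The empty set is the only proper subset of `{X}`, so the minimality clauses amount to the two
  -- conditions given `S` alone.
  have hempty : (∅ : Set I) ⊂ {X} := Set.empty_ssubset.2 (Set.singleton_nonempty X)
  have hVC : V ∉ S ∪ {X} := fun h => h.elim hVS hVX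
  have hWC : W ∉ S ∪ {X} := fun h => h.elim hWS hWX
  have hYC : Y ∉ S ∪ {X} := fun h => h.elim hYS hXY.symm
  have hVY_dep := hindep.2 ∅ hempty
  have hVW_indep := hdep.2 ∅ hempty
  rw [Set.union_empty] at hVY_dep hVW_indep
  obtain ⟨hanc, hchain⟩ := M.graph.extended_y_structure hVX hWX hXY hVS hWS hYS
    (hfaith V Y _ hVY hVC hYC hindep.1)
    (fun h => hVY_dep (hM.condIndepVars hμ hVS hYS h))
    (fun h => hdep.1 (hM.condIndepVars hμ hVC hWC h))
    (hfaith V W _ hVW hVS hWS hVW_indep)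
  exact ⟨hanc, hM.exists_intervention_kernel hμ hchain⟩
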